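/- Let $n\in\mathbb N$, $n\ge 1$, $0<p_1\le p_2<\infty$ and $0<\theta\le\infty$. For $B(0,t)$ the open Euclidean ball of radius $t$ centred at the origin, ${}^{c}B(0,t)=\mathbb R^n\setminus B(0,t)$, a measurable set $A$ and a measurable $w\ge 0$ put $\|g\|_{p,A,w}=\big(\int_A|g|^p w\,dx\big)^{1/p}$ for $0<p<\infty$, $\|g\|_{\infty,A,w}=\operatorname{ess\,sup}_A|g|w$, and $\|g\|_{p,A}=\|g\|_{p,A,1}$. A weight is a measurable function on $\mathbb R^n$ that is positive and finite almost everywhere. For a weight $v$, $L_p(\mathbb R^n,v)$ is the space of measurable $f$ with $\|f\|_{p,\mathbb R^n,v}<\infty$. Let ${}^{c}\Omega_\theta$ be the set of non-negative measurable functions $\omega$ on $(0,\infty)$ with $0<\|\omega\|_{\theta,(0,t)}<\infty$ for all $t>0$. For $\omega\in{}^{c}\Omega_\theta$ and a weight $v$, the weighted complementary local Morrey-type space ${}^{c}LM_{p\theta,\omega}(\mathbb R^n,v)$ consists of all measurable $f$ such that $\|f\|_{p,{}^{c}B(0,t),v}<\infty$ for all $t>0$ and $$\|f\|_{{}^{c}LM_{p\theta,\omega}(\mathbb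 R^n,v)}=\big\|\,\omega(r)\,\|f\|_{p,{}^{c}B(0,r),v}\,\big\|_{\theta,(0,\infty)}<\infty .$$ For weights $v_1,v_2$ on $\mathbb R^n$ let $\|\mathrm{Id}\|\in[0,\infty]$ be the best constant of the embedding ${}^{c}LM_{p_2\theta,\omega}(\mathbb R^n,v_2)\hookrightarrow L_{p_1}(\mathbb R^n,v_1)$, that is, the infimum of all finite $c$ such that every $f$ in the first space lies in the second one and $\|f\|_{L_{p_1}(\mathbb R^n,v_1)}\le c\,\|f\|_{{}^{c}LM_{p_2\theta,\omega}(\mathbb R^n,v_2)}$ (with $\|\mathrm{Id}\|=\infty$ if there is no such $c$). Put $$W(A)=\big\|v_1^{1/p_1}v_2^{-1/p_2}\big\|_{\frac{p_1p_2}{p_2-p_1},A},\qquad \tfrac{p_1p_2}{p_2-p_1}:=\infty\ \text{ if } p_1=p_2 .$$ Then there is a constant $C>0$, depending only on $n,p_1,p_2,\theta$, such that for all weights $v_1,v_2$ on $\mathbb R^n$ and all $\omega\in{}^{c}\Omega_\theta$ the following holds. (a) If $\theta\le p_1$, then $C^{-1}S\le\|\mathrm{Id}\|\le C\,S$, where $$S=\sup_{t>0}\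 \|\omega\|_{\theta,(0,t)}^{-1}\,W(B(0,t)).$$ (b) If $p_1<\theta\le\infty$, then $C^{-1}T\le\|\mathrm{Id}\|\le C\,T$, where, with $r=\frac{p_1\theta}{\theta-p_1}$ ($r=p_1$ if $\theta=\infty$), $$T=\left(\int_{(0,\infty)}W(B(0,t))^{r}\,d\big(-\|\omega\|_{\theta,(0,t+)}^{-r}\big)\right)^{1/r}+\|\omega\|_{\theta,(0,\infty)}^{-1}\,W(\mathbb R^n).$$ Here $\|\omega\|_{\theta,(0,t+)}=\lim_{s\to t+}\|\omega\|_{\theta,(0,s)}$, the integral is the Lebesgue--Stieltjes integral over the open interval $(0,\infty)$ with respect to the finite, non-decreasing, right-continuous function $t\mapsto-\|\omega\|_{\theta,(0,t+)}^{-r}$, all quantities may take the value $\infty$, and $1/\infty=0$, $0\cdot\infty=0$. -/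

import Mathlib

open MeasureTheory Set
open scoped ENNReal NNReal

noncomputable section

namespace WeightedMorrey

/-- `ℝⁿ` with its Euclidean norm and Lebesgue measure. -/
abbrev Rn (n : ℕ) : Type := EuclideanSpace ℝ (Fin n)

/-- The weighted functional `‖g‖_{p,A,w}` of a function `g` with values in `[0,∞]`: it is
`(∫_A g ^ p * w) ^ (1/p)` if `p < ∞`, and `ess sup_A (g * w)` if `p = ∞`. -/
def wnorm {α : Type*} [MeasureSpace α] (p : ℝ≥0∞) (A : Set α) (w g : α → ℝ≥0∞) : ℝ≥0∞ :=
  if p = ∞ then essSup (fun x => g x * w x) (volume.restrict A)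
  else (∫⁻ x in A, g x ^ p.toReal * w x) ^ (1 / p.toReal)

/-- The unweighted functional `‖g‖_{p,A}`. -/
def unorm {α : Type*} [MeasureSpace α] (p : ℝ≥0∞) (A : Set α) (g : α → ℝ≥0∞) : ℝ≥0∞ :=
  wnorm p A (fun _ => 1) g

/-- Weights on `ℝⁿ`: measurable functions that are positive and finite almost everywhere. -/
def IsWeight {n : ℕ} (v : Rn n → ℝ≥0∞) : Prop :=
  AEMeasurable v ∧ ∀ᵐ x, 0 < v x ∧ v x < ∞

/-- The class of non-negative measurable functions `ω` on `(0,∞)` such that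
`0 < ‖ω‖_{θ,(0,t)} < ∞` for all `t > 0`. -/
def DualOmega (θ : ℝ≥0∞) (ω : ℝ → ℝ≥0∞) : Prop :=
  AEMeasurable ω (volume.restrict (Ioi 0)) ∧
    ∀ t : ℝ, 0 < t → 0 < unorm θ (Ioo 0 t) ω ∧ unorm θ (Ioo 0 t) ω < ∞

/-- The quasi-norm of the weighted Lebesgue space `L_p(ℝⁿ, v)`. -/
def lebesgueNorm {n : ℕ} (p : ℝ≥0∞) (v : Rn n → ℝ≥0∞) (f : Rn n → ℝ) : ℝ≥0∞ :=
  wnorm p univ v (fun x => ‖f x‖ₑ)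

/-- The weighted Lebesgue space `L_p(ℝⁿ, v)`. -/
def lebesgueSpace {n : ℕ} (p : ℝ≥0∞) (v : Rn n → ℝ≥0∞) : Set (Rn n → ℝ) :=
  {f | AEMeasurable f ∧ lebesgueNorm p v f < ∞}

/-- The quasi-norm `‖ ω(r) ‖f‖_{p, v, ℝⁿ \ B(0,r)} ‖_{θ,(0,∞)}` of the weighted complementary
local Morrey-type space. -/
def dualMorreyNorm {n : ℕ} (p θ : ℝ≥0∞) (ω : ℝ → ℝ≥0∞) (v : Rn n → ℝ≥0∞)
    (f : Rn n → ℝ) : ℝ≥0∞ :=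
  unorm θ (Ioi 0) (fun r => ω r * wnorm p (Metric.ball 0 r)ᶜ v (fun x => ‖f x‖ₑ))

/-- The weighted complementary local Morrey-type space. -/
def dualMorreySpace {n : ℕ} (p θ : ℝ≥0∞) (ω : ℝ → ℝ≥0∞) (v : Rn n → ℝ≥0∞) :
    Set (Rn n → ℝ) :=
  {f | AEMeasurable f ∧
    (∀ t : ℝ, 0 < t → wnorm p (Metric.ball 0 t)ᶜ v (fun x => ‖f x‖ₑ) < ∞) ∧
    dualMorreyNorm p θ ω v f < ∞}

/-- The norm of the identity `X → Y` between function spaces with quasi-norms `NX`, `NY`: the best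
constant `c` such that `X ⊆ Y` and `NY f ≤ c * NX f` on `X`, and `∞` if there is none. -/
def idNorm {n : ℕ} (X : Set (Rn n → ℝ)) (NX : (Rn n → ℝ) → ℝ≥0∞)
    (Y : Set (Rn n → ℝ)) (NY : (Rn n → ℝ) → ℝ≥0∞) : ℝ≥0∞ :=
  ⨅ (c : ℝ≥0) (_ : ∀ f ∈ X, f ∈ Y ∧ NY f ≤ c * NX f), (c : ℝ≥0∞)

/-- The norm of the identity from the weighted complementary local Morrey-type space with
parameters `p₂, θ, ω, v₂` to `L_{p₁}(ℝⁿ, v₁)`. -/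
def embeddingNorm {n : ℕ} (p₁ p₂ : ℝ) (θ : ℝ≥0∞) (ω : ℝ → ℝ≥0∞) (v₁ v₂ : Rn n → ℝ≥0∞) : ℝ≥0∞ :=
  idNorm (dualMorreySpace (ENNReal.ofReal p₂) θ ω v₂) (dualMorreyNorm (ENNReal.ofReal p₂) θ ω v₂)
    (lebesgueSpace (ENNReal.ofReal p₁) v₁) (lebesgueNorm (ENNReal.ofReal p₁) v₁)

/-- The norm of `v₁ ^ (1/p₁) * v₂ ^ (-1/p₂)` over `A` with exponent `p₁ p₂ / (p₂ - p₁)`;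
the exponent is computed in `[0,∞]`, so that it is `∞` if `p₁ = p₂`. -/
def ratioNorm {n : ℕ} (p₁ p₂ : ℝ) (v₁ v₂ : Rn n → ℝ≥0∞) (A : Set (Rn n)) : ℝ≥0∞ :=
  unorm (ENNReal.ofReal (p₁ * p₂) / ENNReal.ofReal (p₂ - p₁)) A
    (fun x => v₁ x ^ (1 / p₁) * v₂ x ^ (-(1 / p₂)))

/-- The exponent `p₁ θ / (θ - p₁)`, which is `p₁` for `θ = ∞`. -/
def stieltjesExp (p₁ : ℝ) (θ : ℝ≥0∞) : ℝ :=
  if θ = ∞ then p₁ else p₁ * θ.toReal / (θ.toReal - p₁)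

/-- `‖ω‖_{θ,(0,t+)}`, the limit of `‖ω‖_{θ,(0,s)}` as `s → t+`. -/
def omegaRight (θ : ℝ≥0∞) (ω : ℝ → ℝ≥0∞) (t : ℝ) : ℝ≥0∞ :=
  Function.rightLim (fun s : ℝ => unorm θ (Ioo 0 s) ω) t

/-- The function `t ↦ -‖ω‖_{θ,(0,t+)} ^ (-r)` on `(0,∞)`. -/
def negPow (θ : ℝ≥0∞) (ω : ℝ → ℝ≥0∞) (r : ℝ) (t : Ioi (0 : ℝ)) : ℝ :=
  -(omegaRight θ ω t ^ (-r)).toReal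

lemma unorm_mono {α : Type*} [MeasureSpace α] (p : ℝ≥0∞) {A B : Set α} (h : A ⊆ B)
    (g : α → ℝ≥0∞) : unorm p A g ≤ unorm p B g := by
  unfold unorm wnorm
  split_ifs with hp
  · exact essSup_mono_measure' (Measure.restrict_mono h le_rfl)
  · exact ENNReal.rpow_le_rpow (lintegral_mono' (Measure.restrict_mono h le_rfl) le_rfl)
      (by positivity)

lemma monotone_unorm (θ : ℝ≥0∞) (ω : ℝ → ℝ≥0∞) :
    Monotone (fun s : ℝ => unorm θ (Ioo 0 s) ω) :=
  fun _ _ h => unorm_mono θ (Ioo_subset_Ioo_right h) ω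

lemma monotone_negPow {p₁ : ℝ} {θ : ℝ≥0∞} {ω : ℝ → ℝ≥0∞} (hp₁ : 0 < p₁)
    (hθ : ENNReal.ofReal p₁ < θ) (hω : DualOmega θ ω) :
    Monotone (negPow θ ω (stieltjesExp p₁ θ)) := by
  have hr : 0 ≤ stieltjesExp p₁ θ := by
    unfold stieltjesExp
    split_ifs with h
    · exact hp₁.le
    · have : p₁ < θ.toReal := (ENNReal.ofReal_lt_iff_lt_toReal hp₁.le h).1 hθ
      exact div_nonneg (mul_nonneg hp₁.le ENNReal.toReal_nonneg) (by linarith)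
  intro s t hst
  have h0 : 0 < omegaRight θ ω s :=
    (hω.2 s s.2).1.trans_le ((monotone_unorm θ ω).le_rightLim le_rfl)
  have hle : omegaRight θ ω s ≤ omegaRight θ ω t := (monotone_unorm θ ω).rightLim hst
  unfold negPow
  refine neg_le_neg (ENNReal.toReal_mono ?_ ?_)
  · rw [ENNReal.rpow_neg]
    exact ENNReal.inv_ne_top.2 (ENNReal.rpow_pos_of_nonneg h0 hr).ne'
  · rw [ENNReal.rpow_neg, ENNReal.rpow_neg]
    exact ENNReal.inv_le_inv.2 (ENNReal.rpow_le_rpow hle hr)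

instance : CompactIccSpace (Ioi (0 : ℝ)) where
  isCompact_Icc := by
    intro a b
    rw [Subtype.isCompact_iff]
    have : ((↑) : Ioi (0 : ℝ) → ℝ) '' Icc a b = Icc (a : ℝ) b := by
      ext x
      constructor
      · rintro ⟨y, hy, rfl⟩
        exact hy
      · intro hx
        exact ⟨⟨x, lt_of_lt_of_le a.2 hx.1⟩, hx, rfl⟩
    rw [this]
    exact isCompact_Icc

/-- The Lebesgue-Stieltjes measure on `(0,∞)` of a non-decreasing function `h`, which gives mass
`h(b+) - h(a+)` to `(a,b]`. -/
def lebesgueStieltjes {h : Ioi (0 : ℝ) → ℝ} (hh : Monotone h) : Measure (Ioi (0 : ℝ)) :=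
  hh.stieltjesFunction.measure

/-- `sup_{t > 0} ‖ω‖_{θ,(0,t)}⁻¹ ‖v₁ ^ (1/p₁) v₂ ^ (-1/p₂)‖_{p₁p₂/(p₂-p₁), B(0,t)}`. -/
def supQuantity {n : ℕ} (p₁ p₂ : ℝ) (θ : ℝ≥0∞) (ω : ℝ → ℝ≥0∞) (v₁ v₂ : Rn n → ℝ≥0∞) : ℝ≥0∞ :=
  ⨆ (t : ℝ) (_ : 0 < t), (unorm θ (Ioo 0 t) ω)⁻¹ * ratioNorm p₁ p₂ v₁ v₂ (Metric.ball 0 t)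

/-- With `r = p₁ θ / (θ - p₁)` and `W(A) = ‖v₁ ^ (1/p₁) v₂ ^ (-1/p₂)‖_{p₁p₂/(p₂-p₁), A}`, the
quantity `(∫_{(0,∞)} W(B(0,t)) ^ r d(-‖ω‖_{θ,(0,t+)} ^ (-r))) ^ (1/r) + ‖ω‖_{θ,(0,∞)}⁻¹ W(ℝⁿ)`. -/
def stieltjesQuantity {n : ℕ} (p₁ p₂ : ℝ) (θ : ℝ≥0∞) (ω : ℝ → ℝ≥0∞) (v₁ v₂ : Rn n → ℝ≥0∞)
    (hp₁ : 0 < p₁) (hθ : ENNReal.ofReal p₁ < θ) (hω : DualOmega θ ω) : ℝ≥0∞ :=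
  (∫⁻ t : Ioi (0 : ℝ), ratioNorm p₁ p₂ v₁ v₂ (Metric.ball 0 (t : ℝ)) ^ stieltjesExp p₁ θ
      ∂lebesgueStieltjes (monotone_negPow hp₁ hθ hω)) ^ (1 / stieltjesExp p₁ θ)
    + (unorm θ (Ioi 0) ω)⁻¹ * ratioNorm p₁ p₂ v₁ v₂ univ

end WeightedMorrey

end

/-! Write `F(t) = ‖ω‖_{θ,(0,t)}` (`cumul`), a non-decreasing left-continuous function with `F(0) =
0`. The argument discretises along the levels `2^k` of `F`. The sets `E_k = {x : F(|x|) ≤ 2^k}`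
(`radialSub`) are closed balls or all of `ℝⁿ`, and the annuli `A_k = E_{k+1} \ E_k` cover `ℝⁿ` up to
the origin. Using sublevel sets instead of radii with `F = 2^k` accommodates jumps of `F` (possible
for `θ = ∞`) and bounded `F`. The Morrey norm is comparable with the `ℓ_θ` norm of `2^k
‖f‖_{p₂,E_kᶜ,v₂}` (`lintegral_morrey_le`, `tsum_le_dualMorreyNorm`; `essSup_morrey_le`,
`mul_le_essSup_morrey` for `θ = ∞`).

Upper bounds: Hölder on each `A_k` gives `∫|f|^{p₁} v₁ ≤ ∑ (W(E_{k+1}) ‖f‖_{p₂,E_kᶜ,v₂})^{p₁}`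
(`lintegral_le_tsum`). If `θ ≤ p₁`, then `W(E_{k+1}) ≤ 2^{k+1} S` and `ℓ_θ ⊂ ℓ_{p₁}` finish. If `θ >
p₁`, Hölder for sequences with `1/p₁ = 1/r + 1/θ` gives the bound `D^{1/r}`, up to a constant, where
`D = ∑ (2^{-k} W(E_{k+1}))^r` (`ratioSum`).

Lower bounds come from test functions. A near-extremal of Hölder on `B(0,t)` (`exists_extremal`) has
Morrey norm at most `F(t)`, so `S ≤ c`. For `θ > p₁`, near-extremals on the disjoint `A_k` are
combined (`exists_combination`); the Morrey norm is controlled by `discrete_hardy`, or a geometric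
series if `θ = ∞`, and `discrete_hardy'` passes from the `A_k` back to the `E_{k+1}`
(`exists_ratioSum_le`).

Finally `D` is comparable with `T^r`. The second term of `T` acts as an atom of mass
`‖ω‖_{θ,(0,∞)}^{-r}` at infinity. One direction splits the integral over the levels of `F`; the
other (`dyadicSum_le_lebesgueStieltjes`) is a layer cake argument, where at each height the sum of
the `2^{-kr}` is comparable with its largest term. -/

noncomputable section

namespace WeightedMorrey

/-! ### Unweighted norms and increasing unions of sets -/

section Unorm

variable {α : Type*} [MeasureSpace α]

lemma unorm_top_le_iff {A : Set α} {g : α → ℝ≥0∞} {c : ℝ≥0∞} :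
    unorm ∞ A g ≤ c ↔ ∀ᵐ x ∂volume.restrict A, g x ≤ c := by
  simp only [unorm, wnorm, if_true, mul_one]
  exact ⟨fun h => (ENNReal.ae_le_essSup g).mono fun x hx => hx.trans h,
    fun h => essSup_le_of_ae_le c h⟩

lemma unorm_rpow {p : ℝ≥0∞} (h0 : p ≠ 0) (hp : p ≠ ∞) (A : Set α) (g : α → ℝ≥0∞) :
    unorm p A g ^ p.toReal = ∫⁻ x in A, g x ^ p.toReal := by
  have : p.toReal ≠ 0 := (ENNReal.toReal_pos h0 hp).ne'
  simp only [unorm, wnorm, if_neg hp, mul_one]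
  rw [← ENNReal.rpow_mul, one_div_mul_cancel this, ENNReal.rpow_one]

lemma unorm_le_iff {p : ℝ≥0∞} (h0 : p ≠ 0) (hp : p ≠ ∞) {A : Set α} {g : α → ℝ≥0∞}
    {c : ℝ≥0∞} : unorm p A g ≤ c ↔ ∫⁻ x in A, g x ^ p.toReal ≤ c ^ p.toReal := by
  rw [← unorm_rpow h0 hp, ENNReal.rpow_le_rpow_iff (ENNReal.toReal_pos h0 hp)]

lemma unorm_congr_set (p : ℝ≥0∞) {A B : Set α} (h : A =ᵐ[volume] B) (g : α → ℝ≥0∞) :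
    unorm p A g = unorm p B g := by
  simp only [unorm, wnorm, Measure.restrict_congr_set h]

lemma unorm_empty {p : ℝ≥0∞} (h0 : p ≠ 0) (g : α → ℝ≥0∞) : unorm p ∅ g = 0 := by
  by_cases hp : p = ∞
  · subst hp
    exact le_antisymm (unorm_top_le_iff.2 (by simp)) zero_le
  · exact le_antisymm ((unorm_le_iff h0 hp).2 (by simp)) zero_le

/-- Monotone convergence for finite `p`, a countable union of null sets for `p = ∞`. This is the
source of left-continuity in the radius for norms over `(0,t)` and over balls. -/
lemma unorm_iUnion_le {p : ℝ≥0∞} (h0 : p ≠ 0) {s : ℕ → Set α} (hs : Monotone s)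
    {g : α → ℝ≥0∞} {c : ℝ≥0∞} (h : ∀ i, unorm p (s i) g ≤ c) : unorm p (⋃ i, s i) g ≤ c := by
  by_cases hp : p = ∞
  · subst hp
    rw [unorm_top_le_iff, ae_restrict_iUnion_iff]
    exact fun i => unorm_top_le_iff.1 (h i)
  · rw [unorm_le_iff h0 hp, setLIntegral_iUnion_of_directed _ hs.directed_le]
    exact iSup_le fun i => (unorm_le_iff h0 hp).1 (h i)

end Unorm

lemma unorm_Ioo_zero {θ : ℝ≥0∞} (h0 : θ ≠ 0) (ω : ℝ → ℝ≥0∞) {t : ℝ} (ht : t ≤ 0) :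
    unorm θ (Ioo 0 t) ω = 0 := by
  rw [Ioo_eq_empty (not_lt.2 ht), unorm_empty h0]

lemma unorm_Ioo_le {θ : ℝ≥0∞} (h0 : θ ≠ 0) (ω : ℝ → ℝ≥0∞) {t : ℝ} {c : ℝ≥0∞}
    (h : ∀ s < t, unorm θ (Ioo 0 s) ω ≤ c) : unorm θ (Ioo 0 t) ω ≤ c := by
  obtain ⟨u, hu, hut, hlim⟩ := exists_seq_strictMono_tendsto t
  have : Ioo 0 t = ⋃ i, Ioo 0 (u i) := by
    ext x
    simp only [mem_Ioo, mem_iUnion]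
    refine ⟨fun hx => ?_, fun ⟨i, hi⟩ => ⟨hi.1, hi.2.trans (hut i)⟩⟩
    obtain ⟨i, hi⟩ := (hlim.eventually_const_lt hx.2).exists
    exact ⟨i, hx.1, hi⟩
  rw [this]
  exact unorm_iUnion_le h0 (fun i j hij => Ioo_subset_Ioo_right (hu.monotone hij))
    fun i => h _ (hut i)

lemma unorm_Ioi_le {θ : ℝ≥0∞} (h0 : θ ≠ 0) (ω : ℝ → ℝ≥0∞) {c : ℝ≥0∞}
    (h : ∀ s, 0 < s → unorm θ (Ioo 0 s) ω ≤ c) : unorm θ (Ioi 0) ω ≤ c := by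
  have : Ioi (0 : ℝ) = ⋃ i : ℕ, Ioo 0 ((i : ℝ) + 1) := by
    ext x
    simp only [mem_Ioo, mem_iUnion, mem_Ioi]
    refine ⟨fun hx => ?_, fun ⟨i, hi⟩ => hi.1⟩
    obtain ⟨i, hi⟩ := exists_nat_gt x
    exact ⟨i, hx, by linarith⟩
  rw [this]
  exact unorm_iUnion_le h0 (fun i j hij => Ioo_subset_Ioo_right (by gcongr))
    fun i => h _ (by positivity)

lemma unorm_ball_le {n : ℕ} {p : ℝ≥0∞} (h0 : p ≠ 0) (g : Rn n → ℝ≥0∞) {t : ℝ} {c : ℝ≥0∞}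
    (h : ∀ s < t, unorm p (Metric.ball 0 s) g ≤ c) : unorm p (Metric.ball 0 t) g ≤ c := by
  obtain ⟨u, hu, hut, hlim⟩ := exists_seq_strictMono_tendsto t
  have : Metric.ball (0 : Rn n) t = ⋃ i, Metric.ball 0 (u i) := by
    ext x
    simp only [mem_ball_zero_iff, mem_iUnion]
    exact ⟨fun hx => (hlim.eventually_const_lt hx).exists, fun ⟨i, hi⟩ => hi.trans (hut i)⟩
  rw [this]
  exact unorm_iUnion_le h0 (fun i j hij => Metric.ball_subset_ball (hu.monotone hij))
    fun i => h _ (hut i)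

lemma unorm_univ_le {n : ℕ} {p : ℝ≥0∞} (h0 : p ≠ 0) (g : Rn n → ℝ≥0∞) {c : ℝ≥0∞}
    (h : ∀ s, 0 < s → unorm p (Metric.ball 0 s) g ≤ c) : unorm p univ g ≤ c := by
  have : (univ : Set (Rn n)) = ⋃ i : ℕ, Metric.ball 0 ((i : ℝ) + 1) := by
    ext x
    simp only [mem_ball_zero_iff, mem_iUnion, mem_univ, true_iff]
    obtain ⟨i, hi⟩ := exists_nat_gt ‖x‖
    exact ⟨i, by linarith⟩
  rw [this]
  exact unorm_iUnion_le h0 (fun i j hij => Metric.ball_subset_ball (by gcongr))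
    fun i => h _ (by positivity)

/-- The sublevel sets of a non-decreasing left-continuous function. -/
lemma sublevel_dichotomy {F : ℝ → ℝ≥0∞} (hF : Monotone F) (h0 : F 0 = 0)
    (hl : ∀ t c, (∀ s < t, F s ≤ c) → F t ≤ c) (c : ℝ≥0∞) :
    (∃ a, 0 ≤ a ∧ ∀ t, F t ≤ c ↔ t ≤ a) ∨ (∀ t, F t ≤ c) := by
  by_cases h2 : ∀ t, F t ≤ c
  · exact Or.inr h2
  push Not at h2
  obtain ⟨b, hb⟩ := h2
  have htc : F 0 ≤ c := h0.trans_le zero_le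
  have hbd : BddAbove {t | F t ≤ c} :=
    ⟨b, fun s hs => le_of_lt <| lt_of_not_ge fun h => (hb.trans_le (hF h)).not_ge hs⟩
  -- Left-continuity puts the supremum itself into the sublevel set, so the set is closed on the
  -- right.
  have hsup : F (sSup {t | F t ≤ c}) ≤ c := by
    refine hl _ _ fun s hs => ?_
    obtain ⟨u, hu, hsu⟩ := exists_lt_of_lt_csSup ⟨0, htc⟩ hs
    exact (hF hsu.le).trans hu
  exact Or.inl ⟨_, le_csSup hbd htc, fun s =>
    ⟨fun h => le_csSup hbd h, fun h => (hF h).trans hsup⟩⟩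

/-- The function `t ↦ ‖ω‖_{θ,(0,t)}`. -/
def cumul (θ : ℝ≥0∞) (ω : ℝ → ℝ≥0∞) (t : ℝ) : ℝ≥0∞ := unorm θ (Ioo 0 t) ω

/-- The set of the points `x` with `‖ω‖_{θ,(0,|x|)} ≤ c`. -/
def radialSub (n : ℕ) (θ : ℝ≥0∞) (ω : ℝ → ℝ≥0∞) (c : ℝ≥0∞) : Set (Rn n) :=
  {x | cumul θ ω ‖x‖ ≤ c}

/-! ### Sublevel sets of `‖ω‖_{θ,(0,|x|)}` as closed balls -/

section Radial

variable {n : ℕ} {θ : ℝ≥0∞} {ω : ℝ → ℝ≥0∞}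

lemma monotone_cumul : Monotone (cumul θ ω) := monotone_unorm θ ω

lemma cumul_zero (h0 : θ ≠ 0) : cumul θ ω 0 = 0 := unorm_Ioo_zero h0 ω le_rfl

lemma cumul_dichotomy (h0 : θ ≠ 0) (c : ℝ≥0∞) :
    (∃ a, 0 ≤ a ∧ ∀ t, cumul θ ω t ≤ c ↔ t ≤ a) ∨ (∀ t, cumul θ ω t ≤ c) :=
  sublevel_dichotomy monotone_cumul (cumul_zero h0) (fun _ _ h => unorm_Ioo_le h0 ω h) c

lemma measurable_cumul : Measurable (cumul θ ω) := monotone_cumul.measurable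

lemma measurableSet_radialSub (c : ℝ≥0∞) : MeasurableSet (radialSub n θ ω c) :=
  measurableSet_le (measurable_cumul.comp measurable_norm) measurable_const

lemma nontrivial_Rn (hn : 1 ≤ n) : Nontrivial (Rn n) := by
  have : Nonempty (Fin n) := ⟨⟨0, hn⟩⟩
  infer_instance

/-- Spheres are null. Positive dimension matters for `a = 0`, where the difference is the single
point `0`. -/
lemma closedBall_ae_eq_ball (hn : 1 ≤ n) (a : ℝ) :
    Metric.closedBall (0 : Rn n) a =ᵐ[volume] Metric.ball (0 : Rn n) a := by
  have := nontrivial_Rn hn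
  refine (ae_eq_of_subset_of_measure_ge Metric.ball_subset_closedBall ?_
    measurableSet_ball.nullMeasurableSet measure_closedBall_lt_top.ne).symm
  rw [Measure.addHaar_closedBall_eq_addHaar_ball]

lemma radialSub_dichotomy (n : ℕ) (h0 : θ ≠ 0) (c : ℝ≥0∞) :
    (∃ a, 0 ≤ a ∧ (∀ t, cumul θ ω t ≤ c ↔ t ≤ a) ∧
      radialSub n θ ω c = Metric.closedBall (0 : Rn n) a) ∨
    ((∀ t, cumul θ ω t ≤ c) ∧ radialSub n θ ω c = univ) := by
  rcases cumul_dichotomy (ω := ω) h0 c with ⟨a, ha, h⟩ | h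
  · refine Or.inl ⟨a, ha, h, ?_⟩
    ext x
    simp [radialSub, h]
  · exact Or.inr ⟨h, eq_univ_of_forall fun x => h ‖x‖⟩

end Radial

/-! ### Hölder's inequality between weighted Lebesgue spaces -/

section Ratio

variable {n : ℕ} {p₁ p₂ : ℝ} {v₁ v₂ : Rn n → ℝ≥0∞}

/-- The quotient `v₁ ^ (1/p₁) * v₂ ^ (-1/p₂)` of weights. -/
def ratio (p₁ p₂ : ℝ) (v₁ v₂ : Rn n → ℝ≥0∞) (x : Rn n) : ℝ≥0∞ :=
  v₁ x ^ (1 / p₁) * v₂ x ^ (-(1 / p₂))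

lemma ratioNorm_eq_unorm (A : Set (Rn n)) :
    ratioNorm p₁ p₂ v₁ v₂ A =
      unorm (ENNReal.ofReal (p₁ * p₂) / ENNReal.ofReal (p₂ - p₁)) A (ratio p₁ p₂ v₁ v₂) := rfl

lemma ratioExp_ne_zero (hp₁ : 0 < p₁) (hp : p₁ ≤ p₂) :
    ENNReal.ofReal (p₁ * p₂) / ENNReal.ofReal (p₂ - p₁) ≠ 0 :=
  ENNReal.div_ne_zero.2 ⟨(ENNReal.ofReal_pos.2 (mul_pos hp₁ (hp₁.trans_le hp))).ne',
    ENNReal.ofReal_ne_top⟩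

lemma ratioNorm_of_eq (hp₁ : 0 < p₁) (A : Set (Rn n)) :
    ratioNorm p₁ p₁ v₁ v₂ A = unorm ∞ A (ratio p₁ p₁ v₁ v₂) := by
  rw [ratioNorm_eq_unorm, sub_self, ENNReal.ofReal_zero, ENNReal.div_zero]
  exact (ENNReal.ofReal_pos.2 (mul_pos hp₁ hp₁)).ne'

lemma ratioNorm_of_lt (hp₁ : 0 < p₁) (hp : p₁ < p₂) (A : Set (Rn n)) :
    ratioNorm p₁ p₂ v₁ v₂ A =
      (∫⁻ x in A, ratio p₁ p₂ v₁ v₂ x ^ (p₁ * p₂ / (p₂ - p₁))) ^ (1 / (p₁ * p₂ / (p₂ - p₁))) := by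
  have h : 0 < p₂ - p₁ := sub_pos.2 hp
  have h' : 0 < p₁ * p₂ / (p₂ - p₁) := div_pos (mul_pos hp₁ (hp₁.trans hp)) h
  rw [ratioNorm_eq_unorm, ← ENNReal.ofReal_div_of_pos h]
  simp [unorm, wnorm, ENNReal.toReal_ofReal h'.le]

lemma aemeasurable_ratio (hv₁ : IsWeight v₁) (hv₂ : IsWeight v₂) :
    AEMeasurable (ratio p₁ p₂ v₁ v₂) :=
  (hv₁.1.pow_const _).mul (hv₂.1.pow_const _)

lemma ratio_rpow_mul {a b : ℝ≥0∞} (hp₁ : 0 < p₁) (hb : 0 < b ∧ b < ∞) :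
    (a ^ (1 / p₁) * b ^ (-(1 / p₂))) ^ p₁ * b ^ (p₁ / p₂) = a := by
  rw [ENNReal.mul_rpow_of_nonneg _ _ hp₁.le, ← ENNReal.rpow_mul, ← ENNReal.rpow_mul, mul_assoc,
    ← ENNReal.rpow_add _ _ hb.1.ne' hb.2.ne, one_div_mul_cancel hp₁.ne', ENNReal.rpow_one,
    show -(1 / p₂) * p₁ + p₁ / p₂ = 0 by ring, ENNReal.rpow_zero, mul_one]

lemma rpow_mul_weight_eq (hp₁ : 0 < p₁) (hp : p₁ ≤ p₂) (g : ℝ≥0∞) {a b : ℝ≥0∞}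
    (hb : 0 < b ∧ b < ∞) :
    g ^ p₁ * a = (a ^ (1 / p₁) * b ^ (-(1 / p₂))) ^ p₁ * (g ^ p₂ * b) ^ (p₁ / p₂) := by
  have hp₂ := hp₁.trans_le hp
  rw [ENNReal.mul_rpow_of_nonneg _ _ (div_pos hp₁ hp₂).le, ← ENNReal.rpow_mul,
    mul_div_cancel₀ _ hp₂.ne', mul_left_comm, ratio_rpow_mul hp₁ hb]

/-- The integrand factors pointwise as `ratio ^ p₁ * (g ^ p₂ v₂) ^ (p₁/p₂)`. Hölder with exponents
`p₂/(p₂-p₁)` and `p₂/p₁` applies; for `p₁ = p₂` the first factor is bounded by its essential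
supremum. -/
lemma lintegral_le_ratioNorm_mul (hp₁ : 0 < p₁) (hp : p₁ ≤ p₂) (hv₁ : IsWeight v₁)
    (hv₂ : IsWeight v₂) (A : Set (Rn n)) {g : Rn n → ℝ≥0∞} (hg : AEMeasurable g) :
    ∫⁻ x in A, g x ^ p₁ * v₁ x ≤
      ratioNorm p₁ p₂ v₁ v₂ A ^ p₁ * (∫⁻ x in A, g x ^ p₂ * v₂ x) ^ (p₁ / p₂) := by
  have hp₂ := hp₁.trans_le hp
  have hm : AEMeasurable (fun x => g x ^ p₂ * v₂ x) (volume.restrict A) :=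
    ((hg.pow_const _).mul hv₂.1).restrict
  have key : ∫⁻ x in A, g x ^ p₁ * v₁ x =
      ∫⁻ x in A, ratio p₁ p₂ v₁ v₂ x ^ p₁ * (g x ^ p₂ * v₂ x) ^ (p₁ / p₂) :=
    lintegral_congr_ae <| ae_restrict_of_ae <| hv₂.2.mono fun x hx =>
      rpow_mul_weight_eq hp₁ hp _ hx
  rw [key]
  rcases hp.eq_or_lt with rfl | hlt
  · rw [ratioNorm_of_eq hp₁, div_self hp₁.ne', ENNReal.rpow_one, ← lintegral_const_mul'' _ hm]
    refine lintegral_mono_ae ?_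
    filter_upwards [unorm_top_le_iff.1 (le_refl (unorm ∞ A (ratio p₁ p₁ v₁ v₂)))] with x hx
    rw [ENNReal.rpow_one]
    gcongr
  · have h : 0 < p₂ - p₁ := sub_pos.2 hlt
    have hconj : (p₂ / (p₂ - p₁)).HolderConjugate (p₂ / p₁) := by
      rw [Real.holderConjugate_iff]
      refine ⟨(one_lt_div h).2 (by linarith), ?_⟩
      field_simp
      ring
    refine (ENNReal.lintegral_mul_le_Lp_mul_Lq _ hconj
      ((aemeasurable_ratio hv₁ hv₂).pow_const p₁).restrict (hm.pow_const _)).trans_eq ?_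
    rw [ratioNorm_of_lt hp₁ hlt, ← ENNReal.rpow_mul]
    congr 2
    · simp_rw [← ENNReal.rpow_mul, mul_div_assoc]
    · field_simp
    · simp_rw [← ENNReal.rpow_mul, div_mul_div_cancel₀ hp₂.ne', div_self hp₁.ne', ENNReal.rpow_one]
    · rw [one_div_div]

end Ratio

section Ratio

variable {n : ℕ} {p₁ p₂ : ℝ} {v₁ v₂ : Rn n → ℝ≥0∞}

lemma indicator_rpow_mul {α : Type*} {p : ℝ} (hp : 0 < p) (t : Set α) (g v : α → ℝ≥0∞) (x : α) :
    t.indicator g x ^ p * v x = t.indicator (fun x => g x ^ p * v x) x := by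
  by_cases hx : x ∈ t <;> simp [hx, hp]

lemma exists_real_of_ennreal (hp₁ : 0 < p₁) (hp : p₁ ≤ p₂) {t A : Set (Rn n)}
    (ht : MeasurableSet t) (htA : t ⊆ A) {g : Rn n → ℝ≥0∞} (hg : AEMeasurable g)
    (hfin : ∀ᵐ x, g x < ∞) {l : ℝ≥0∞} (h2 : ∫⁻ x in t, g x ^ p₂ * v₂ x ≤ 1)
    (h1 : l ≤ ∫⁻ x in t, g x ^ p₁ * v₁ x) :
    ∃ f : Rn n → ℝ, AEMeasurable f ∧ (∀ x, x ∉ A → f x = 0) ∧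
      ∫⁻ x, ‖f x‖ₑ ^ p₂ * v₂ x ≤ 1 ∧ l ≤ ∫⁻ x, ‖f x‖ₑ ^ p₁ * v₁ x := by
  have hp₂ := hp₁.trans_le hp
  have hae : ∀ᵐ x, ‖(t.indicator g x).toReal‖ₑ = t.indicator g x := hfin.mono fun x hx => by
    rw [Real.enorm_eq_ofReal ENNReal.toReal_nonneg, ENNReal.ofReal_toReal]
    exact ((indicator_le_self t g x).trans_lt hx).ne
  refine ⟨fun x => (t.indicator g x).toReal, (hg.indicator ht).ennreal_toReal, fun x hx => ?_,
    ?_, ?_⟩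
  · simp [indicator_of_notMem (fun h => hx (htA h))]
  · rwa [lintegral_congr_ae (g := t.indicator fun x => g x ^ p₂ * v₂ x), lintegral_indicator ht]
    exact hae.mono fun x hx => by simp only [hx, indicator_rpow_mul hp₂]
  · rwa [lintegral_congr_ae (g := t.indicator fun x => g x ^ p₁ * v₁ x), lintegral_indicator ht]
    exact hae.mono fun x hx => by simp only [hx, indicator_rpow_mul hp₁]

lemma ratio_pos_lt_top (hp₁ : 0 < p₁) (hv₁ : IsWeight v₁) (hv₂ : IsWeight v₂) :
    ∀ᵐ x, 0 < ratio p₁ p₂ v₁ v₂ x ∧ ratio p₁ p₂ v₁ v₂ x < ∞ := by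
  filter_upwards [hv₁.2, hv₂.2] with x h1 h2
  exact ⟨ENNReal.mul_pos (ENNReal.rpow_pos h1.1 h1.2.ne).ne' (ENNReal.rpow_pos h2.1 h2.2.ne).ne',
    ENNReal.mul_lt_top (ENNReal.rpow_lt_top_of_nonneg (by positivity) h1.2.ne)
      (by simp [h2.1.ne', h2.2.ne, ENNReal.rpow_neg, lt_top_iff_ne_top])⟩

/-- Sharpness of Hölder's inequality between two weighted Lebesgue spaces. -/
lemma exists_extremal (hp₁ : 0 < p₁) (hp : p₁ ≤ p₂) (hv₁ : IsWeight v₁) (hv₂ : IsWeight v₂)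
    {A : Set (Rn n)} (hA : MeasurableSet A) {l : ℝ≥0∞} (hl : l < ratioNorm p₁ p₂ v₁ v₂ A) :
    ∃ f : Rn n → ℝ, AEMeasurable f ∧ (∀ x, x ∉ A → f x = 0) ∧
      ∫⁻ x, ‖f x‖ₑ ^ p₂ * v₂ x ≤ 1 ∧ l ^ p₁ ≤ ∫⁻ x, ‖f x‖ₑ ^ p₁ * v₁ x := by
  have hp₂ := hp₁.trans_le hp
  rcases hp.eq_or_lt with rfl | hlt
  · rw [ratioNorm_of_eq hp₁] at hl
    obtain ⟨φ, hφ, hφe⟩ := aemeasurable_ratio (p₁ := p₁) (p₂ := p₁) hv₁ hv₂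
    have hS : MeasurableSet (A ∩ {x | l < φ x}) := hA.inter (measurableSet_lt measurable_const hφ)
    have hv2ne : ∀ᵐ x, v₂ x ≠ 0 := hv₂.2.mono fun x hx => hx.1.ne'
    -- For `p₁ = p₂` the near-extremal is a normalised constant on a piece, of finite positive
    -- `v₂`-mass, of the set where the quotient exceeds `l`.
    have hpos : 0 < volume.withDensity v₂ (A ∩ {x | l < φ x}) := by
      refine pos_iff_ne_zero.2 fun h => hl.not_ge (unorm_top_le_iff.2 ?_)
      have h' := withDensity_absolutelyContinuous' hv₂.1 hv2ne h
      rw [ae_restrict_iff' hA]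
      filter_upwards [hφe, measure_eq_zero_iff_ae_notMem.1 h'] with x hx hx' hxA
      rw [hx]
      exact not_lt.1 fun hlt => hx' ⟨hxA, hlt⟩
    have hsf : SigmaFinite (volume.withDensity v₂) :=
      SigmaFinite.withDensity_of_ne_top (hv₂.2.mono fun x hx => hx.2.ne)
    obtain ⟨t, ht, htS, ht0, htt⟩ := Measure.exists_subset_measure_lt_top hS hpos
    rw [withDensity_apply _ ht] at ht0 htt
    set I := ∫⁻ x in t, v₂ x with hI
    have hint : ∫⁻ x in t, (I⁻¹ ^ (1 / p₁)) ^ p₁ * v₂ x = 1 := by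
      rw [lintegral_const_mul'' _ hv₂.1.restrict, ← ENNReal.rpow_mul, one_div_mul_cancel hp₁.ne',
        ENNReal.rpow_one, ← hI, ENNReal.inv_mul_cancel ht0.ne' htt.ne]
    refine exists_real_of_ennreal hp₁ le_rfl ht (htS.trans inter_subset_left)
      (g := fun _ => I⁻¹ ^ (1 / p₁)) aemeasurable_const (.of_forall fun _ => ?_) hint.le ?_
    · exact ENNReal.rpow_lt_top_of_nonneg (by positivity) (ENNReal.inv_ne_top.2 ht0.ne')
    · calc l ^ p₁ = l ^ p₁ * ∫⁻ x in t, (I⁻¹ ^ (1 / p₁)) ^ p₁ * v₂ x := by rw [hint, mul_one]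
        _ = ∫⁻ x in t, l ^ p₁ * ((I⁻¹ ^ (1 / p₁)) ^ p₁ * v₂ x) :=
          (lintegral_const_mul'' _ (hv₂.1.restrict.const_mul _)).symm
        _ ≤ _ := by
          refine lintegral_mono_ae ((ae_restrict_iff' ht).2 ?_)
          filter_upwards [hv₂.2, hφe] with x hx hφx hxt
          rw [rpow_mul_weight_eq hp₁ le_rfl _ (a := v₁ x) hx, div_self hp₁.ne', ENNReal.rpow_one]
          gcongr
          exact le_of_lt (lt_of_lt_of_eq (htS hxt).2 hφx.symm)
  · have h : 0 < p₂ - p₁ := sub_pos.2 hlt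
    rw [ratioNorm_of_lt hp₁ hlt] at hl
    set ρ := p₁ * p₂ / (p₂ - p₁) with hρ
    have hρ0 : 0 < ρ := div_pos (mul_pos hp₁ hp₂) h
    rw [one_div, ENNReal.lt_rpow_inv_iff hρ0] at hl
    set ψ : Rn n → ℝ≥0∞ := fun x => ratio p₁ p₂ v₁ v₂ x ^ ρ with hψ
    have hψm : AEMeasurable ψ := (aemeasurable_ratio hv₁ hv₂).pow_const _
    have hψf : ∀ᵐ x, 0 < ψ x ∧ ψ x < ∞ := (ratio_pos_lt_top (p₂ := p₂) hp₁ hv₁ hv₂).mono fun x hx =>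
      ⟨ENNReal.rpow_pos hx.1 hx.2.ne, ENNReal.rpow_lt_top_of_nonneg hρ0.le hx.2.ne⟩
    have hsf : SigmaFinite (volume.withDensity ψ) :=
      SigmaFinite.withDensity_of_ne_top (hψf.mono fun x hx => hx.2.ne)
    rw [← withDensity_apply _ hA] at hl
    -- Passing to a subset whose mass is finite but still above `l ^ ρ` covers the case of an
    -- infinite norm over `A`.
    obtain ⟨t, ht, htA, ht0, htt⟩ := Measure.exists_subset_measure_lt_top hA hl
    rw [withDensity_apply _ ht] at ht0 htt
    set I := ∫⁻ x in t, ψ x with hI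
    have hI0 : I ≠ 0 := (zero_le.trans_lt ht0).ne'
    -- Equality case of Hölder: the test function makes `g ^ p₂ v₂` proportional to `ratio ^ ρ`,
    -- normalised on `t`.
    have hg : ∀ᵐ x, ((ψ x * I⁻¹ * (v₂ x)⁻¹) ^ (1 / p₂)) ^ p₂ * v₂ x = ψ x * I⁻¹ :=
      hv₂.2.mono fun x hx => by
        rw [← ENNReal.rpow_mul, one_div_mul_cancel hp₂.ne', ENNReal.rpow_one, mul_assoc,
          ENNReal.inv_mul_cancel hx.1.ne' hx.2.ne, mul_one]
    refine exists_real_of_ennreal hp₁ hp ht htA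
      (g := fun x => (ψ x * I⁻¹ * (v₂ x)⁻¹) ^ (1 / p₂))
      (((hψm.mul_const _).mul hv₂.1.inv).pow_const _) ?_ ?_ ?_
    · filter_upwards [hv₂.2, hψf] with x hx hx'
      exact ENNReal.rpow_lt_top_of_nonneg (by positivity) (ENNReal.mul_ne_top
        (ENNReal.mul_ne_top hx'.2.ne (ENNReal.inv_ne_top.2 hI0)) (ENNReal.inv_ne_top.2 hx.1.ne'))
    · rw [lintegral_congr_ae (ae_restrict_of_ae hg), lintegral_mul_const'' _ hψm.restrict, ← hI,
        ENNReal.mul_inv_cancel hI0 htt.ne]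
    · have hpt : ∀ᵐ x, ((ψ x * I⁻¹ * (v₂ x)⁻¹) ^ (1 / p₂)) ^ p₁ * v₁ x =
          ψ x * I⁻¹ ^ (p₁ / p₂) := by
        filter_upwards [hv₂.2, ratio_pos_lt_top (p₂ := p₂) hp₁ hv₁ hv₂, hg] with x hx hx' hgx
        rw [rpow_mul_weight_eq hp₁ hp _ hx, hgx,
          ENNReal.mul_rpow_of_nonneg _ _ (div_pos hp₁ hp₂).le, ← mul_assoc]
        congr 1
        change ratio p₁ p₂ v₁ v₂ x ^ p₁ * (ratio p₁ p₂ v₁ v₂ x ^ ρ) ^ (p₁ / p₂) =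
          ratio p₁ p₂ v₁ v₂ x ^ ρ
        rw [← ENNReal.rpow_mul, ← ENNReal.rpow_add _ _ hx'.1.ne' hx'.2.ne]
        congr 1
        rw [hρ]
        field_simp
        ring
      rw [lintegral_congr_ae (ae_restrict_of_ae hpt), lintegral_mul_const'' _ hψm.restrict, ← hI,
        ENNReal.inv_rpow, ← ENNReal.rpow_neg]
      nth_rewrite 1 [← ENNReal.rpow_one I]
      rw [← ENNReal.rpow_add _ _ hI0 htt.ne]
      have he : 1 + -(p₁ / p₂) = p₁ * ρ⁻¹ := by
        rw [hρ]
        field_simp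
        ring
      have hlρ : l ^ p₁ = (l ^ ρ) ^ (p₁ * ρ⁻¹) := by
        rw [← ENNReal.rpow_mul]
        congr 1
        field_simp
      rw [he, hlρ]
      exact ENNReal.rpow_le_rpow ht0.le (by positivity)

end Ratio

/-! ### Dyadic discretisation of the Morrey norm -/

section Discretization

variable {n : ℕ} {θ : ℝ≥0∞} {ω : ℝ → ℝ≥0∞}

/-- The set of the `t > 0` with `‖ω‖_{θ,(0,t)} ≤ c`. -/
def lowerSet (θ : ℝ≥0∞) (ω : ℝ → ℝ≥0∞) (c : ℝ≥0∞) : Set ℝ := {t | 0 < t ∧ cumul θ ω t ≤ c}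

/-- The set of the `t > 0` with `2 ^ k < ‖ω‖_{θ,(0,t)} ≤ 2 ^ (k + 1)`. -/
def dyadicSet (θ : ℝ≥0∞) (ω : ℝ → ℝ≥0∞) (k : ℤ) : Set ℝ :=
  {t | 0 < t ∧ cumul θ ω t ∈ Ioc ((2 : ℝ≥0∞) ^ k) (2 ^ (k + 1))}

lemma measurableSet_dyadicSet (k : ℤ) : MeasurableSet (dyadicSet θ ω k) :=
  measurableSet_Ioi.inter (measurable_cumul measurableSet_Ioc)

lemma dyadicSet_subset_lowerSet (k : ℤ) : dyadicSet θ ω k ⊆ lowerSet θ ω (2 ^ (k + 1)) :=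
  fun _ ht => ⟨ht.1, ht.2.2⟩

lemma dyadicSet_subset_Ioi (k : ℤ) : dyadicSet θ ω k ⊆ Ioi 0 := fun _ ht => ht.1

lemma exists_mem_Ioc_two_zpow {x : ℝ≥0∞} (h0 : x ≠ 0) (h : x ≠ ∞) :
    ∃ k : ℤ, x ∈ Ioc ((2 : ℝ≥0∞) ^ k) (2 ^ (k + 1)) :=
  ENNReal.exists_mem_Ioc_zpow h0 h ENNReal.one_lt_two ENNReal.ofNat_ne_top

lemma zpow_two_mono : Monotone fun k : ℤ => (2 : ℝ≥0∞) ^ k :=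
  ENNReal.monotone_zpow ENNReal.one_lt_two.le

lemma disjoint_Ioc_two_zpow {k j : ℤ} (h : k ≠ j) :
    Disjoint (Ioc ((2 : ℝ≥0∞) ^ k) (2 ^ (k + 1))) (Ioc ((2 : ℝ≥0∞) ^ j) (2 ^ (j + 1))) := by
  wlog hlt : k < j generalizing k j
  · exact (this h.symm (lt_of_le_of_ne (not_lt.1 hlt) h.symm)).symm
  exact Set.disjoint_left.2 fun x hx hx' =>
    (hx.2.trans (zpow_two_mono (Int.add_one_le_iff.2 hlt))).not_gt hx'.1

lemma pairwise_disjoint_dyadicSet : Pairwise (Function.onFun Disjoint (dyadicSet θ ω)) :=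
  fun _ _ h => Set.disjoint_left.2 fun _ hx hx' =>
    Set.disjoint_left.1 (disjoint_Ioc_two_zpow h) hx.2 hx'.2

lemma iUnion_dyadicSet (hω : DualOmega θ ω) : ⋃ k, dyadicSet θ ω k = Ioi 0 := by
  refine subset_antisymm (iUnion_subset dyadicSet_subset_Ioi) fun t ht => mem_iUnion.2 ?_
  obtain ⟨k, hk⟩ := exists_mem_Ioc_two_zpow (hω.2 t ht).1.ne' (hω.2 t ht).2.ne
  exact ⟨k, ht, hk⟩

lemma unorm_lowerSet_le (h0 : θ ≠ 0) (c : ℝ≥0∞) : unorm θ (lowerSet θ ω c) ω ≤ c := by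
  rcases cumul_dichotomy (ω := ω) h0 c with ⟨a, ha, h⟩ | h
  · have : lowerSet θ ω c = Ioc 0 a := by
      ext t
      simp [lowerSet, h]
    rw [this, unorm_congr_set θ Ioo_ae_eq_Ioc.symm]
    exact (h a).2 le_rfl
  · have : lowerSet θ ω c = Ioi 0 := by
      ext t
      simp [lowerSet, h]
    rw [this]
    exact unorm_Ioi_le h0 ω fun s _ => h s

/-- For `θ < ∞` the cumulative norm is also right-continuous, by continuity from above of the
measure `ω ^ θ dt`. Hence at the endpoint `a` of `{F ≤ c}` the value `c` is attained, provided `F`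
exceeds `c` somewhere. -/
lemma le_lintegral_lowerSet (h0 : θ ≠ 0) (hθ : θ ≠ ∞) (hω : DualOmega θ ω) {c : ℝ≥0∞} {t : ℝ}
    (hc : c < cumul θ ω t) : c ^ θ.toReal ≤ ∫⁻ s in lowerSet θ ω c, ω s ^ θ.toReal := by
  rcases cumul_dichotomy (ω := ω) h0 c with ⟨a, ha, h⟩ | h
  swap
  · exact absurd (h t) hc.not_ge
  have hsub : Ioc 0 a ⊆ lowerSet θ ω c := fun s hs => ⟨hs.1, (h s).2 hs.2⟩
  refine le_trans ?_ (lintegral_mono_set hsub)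
  set m := volume.withDensity (fun s => ω s ^ θ.toReal) with hm
  have hfin : ∀ b : ℝ, a < b → ∫⁻ s in Ioo 0 b, ω s ^ θ.toReal ≠ ∞ := fun b hb => by
    rw [← unorm_rpow h0 hθ]
    exact ENNReal.rpow_ne_top_of_nonneg ENNReal.toReal_nonneg (hω.2 b (ha.trans_lt hb)).2.ne
  have hInter : Ioc 0 a = ⋂ i : ℕ, Ioo 0 (a + 1 / ((i : ℝ) + 1)) := by
    ext s
    simp only [mem_Ioc, mem_iInter, mem_Ioo]
    refine ⟨fun hs i => ⟨hs.1, hs.2.trans_lt (by have : (0:ℝ) < 1 / ((i : ℝ) + 1) := by positivity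
                                                 linarith)⟩, fun hs => ⟨(hs 0).1, ?_⟩⟩
    refine le_of_forall_pos_le_add fun ε hε => ?_
    obtain ⟨i, hi⟩ := exists_nat_one_div_lt hε
    linarith [(hs i).2]
  have hanti : Antitone fun i : ℕ => Ioo (0 : ℝ) (a + 1 / ((i : ℝ) + 1)) := fun i j hij =>
    Ioo_subset_Ioo_right (by gcongr)
  have hlim := tendsto_measure_iInter_atTop (μ := m)
    (fun i : ℕ => (measurableSet_Ioo :
      MeasurableSet (Ioo (0:ℝ) (a + 1 / ((i : ℝ) + 1)))).nullMeasurableSet)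
    hanti ⟨0, by rw [hm, withDensity_apply _ measurableSet_Ioo]; exact hfin _ (by simp)⟩
  rw [← hInter, hm, withDensity_apply _ measurableSet_Ioc] at hlim
  refine ge_of_tendsto' hlim fun i => ?_
  have hai : a < a + 1 / ((i : ℝ) + 1) := by
    have : (0:ℝ) < 1 / ((i : ℝ) + 1) := by positivity
    linarith
  simp only [Function.comp]
  rw [withDensity_apply _ measurableSet_Ioo, ← unorm_rpow h0 hθ]
  exact ENNReal.rpow_le_rpow (not_le.1 fun h' => hai.not_ge ((h _).1 h')).le ENNReal.toReal_nonneg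

lemma ball_subset_radialSub {c : ℝ≥0∞} {t : ℝ} (h : cumul θ ω t ≤ c) :
    Metric.ball (0 : Rn n) t ⊆ radialSub n θ ω c := fun _ hx =>
  (monotone_cumul (mem_ball_zero_iff.1 hx).le).trans h

lemma radialSub_subset_ball {c : ℝ≥0∞} {t : ℝ} (h : c < cumul θ ω t) :
    radialSub n θ ω c ⊆ Metric.ball (0 : Rn n) t := fun _ hx =>
  mem_ball_zero_iff.2 (not_le.1 fun h' => (h.trans_le (monotone_cumul h')).not_ge hx)

variable {s : ℝ} {u : Rn n → ℝ≥0∞}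

/-- For `r` in the `k`-th dyadic set `F(r) > 2^k`, so the complement of `B(0,r)` lies in that of
`E_k`, while `ω ^ θ` has mass at most `(2^{k+1})^θ` there. -/
lemma lintegral_morrey_le (h0 : θ ≠ 0) (hθ : θ ≠ ∞) (hω : DualOmega θ ω) (hs : 0 ≤ s) :
    ∫⁻ r in Ioi 0, (ω r * (∫⁻ x in (Metric.ball 0 r)ᶜ, u x) ^ s) ^ θ.toReal ≤
      ∑' k : ℤ, ((2 : ℝ≥0∞) ^ (k + 1) * (∫⁻ x in (radialSub n θ ω (2 ^ k))ᶜ, u x) ^ s) ^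
        θ.toReal := by
  have hθ' := ENNReal.toReal_nonneg (a := θ)
  rw [← iUnion_dyadicSet hω]
  refine (lintegral_iUnion_le _ _).trans (ENNReal.tsum_le_tsum fun k => ?_)
  calc ∫⁻ r in dyadicSet θ ω k, (ω r * (∫⁻ x in (Metric.ball 0 r)ᶜ, u x) ^ s) ^ θ.toReal
    _ ≤ ∫⁻ r in dyadicSet θ ω k, ω r ^ θ.toReal *
        ((∫⁻ x in (radialSub n θ ω (2 ^ k))ᶜ, u x) ^ s) ^ θ.toReal := by
      refine setLIntegral_mono' (measurableSet_dyadicSet k) fun r hr => ?_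
      rw [ENNReal.mul_rpow_of_nonneg _ _ hθ']
      gcongr
      exact radialSub_subset_ball hr.2.1
    _ = (∫⁻ r in dyadicSet θ ω k, ω r ^ θ.toReal) *
        ((∫⁻ x in (radialSub n θ ω (2 ^ k))ᶜ, u x) ^ s) ^ θ.toReal :=
      lintegral_mul_const'' _ ((hω.1.mono_set (dyadicSet_subset_Ioi k)).pow_const _)
    _ ≤ _ := by
      rw [ENNReal.mul_rpow_of_nonneg _ _ hθ']
      gcongr
      exact (lintegral_mono_set (dyadicSet_subset_lowerSet k)).trans
        ((unorm_le_iff h0 hθ).1 (unorm_lowerSet_le h0 _))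

lemma essSup_morrey_le (hω : DualOmega ∞ ω) (hs : 0 ≤ s) :
    unorm ∞ (Ioi 0) (fun r => ω r * (∫⁻ x in (Metric.ball 0 r)ᶜ, u x) ^ s) ≤
      ⨆ k : ℤ, (2 : ℝ≥0∞) ^ (k + 1) * (∫⁻ x in (radialSub n ∞ ω (2 ^ k))ᶜ, u x) ^ s := by
  rw [unorm_top_le_iff, ← iUnion_dyadicSet hω, ae_restrict_iUnion_iff]
  intro k
  have h1 := unorm_top_le_iff.1 (unorm_lowerSet_le (ω := ω) ENNReal.top_ne_zero (2 ^ (k + 1)))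
  have h2 := ae_restrict_of_ae_restrict_of_subset (dyadicSet_subset_lowerSet k) h1
  filter_upwards [h2, ae_restrict_mem (measurableSet_dyadicSet k)] with r hr hrk
  refine le_trans ?_ (le_iSup _ k)
  gcongr
  exact radialSub_subset_ball hrk.2.1

/-- On the `k`-th dyadic set the ball complement contains that of `E_{k+1}`, and the mass of `ω ^ θ`
is at least the difference of the two powers. -/
lemma tsum_le_lintegral_morrey (h0 : θ ≠ 0) (hθ : θ ≠ ∞) (hω : DualOmega θ ω) (hs : 0 < s) :
    ∑' k : ℤ, (((2 : ℝ≥0∞) ^ (k + 1)) ^ θ.toReal - ((2 : ℝ≥0∞) ^ k) ^ θ.toReal) *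
      ((∫⁻ x in (radialSub n θ ω (2 ^ (k + 1)))ᶜ, u x) ^ s) ^ θ.toReal ≤
    ∫⁻ r in Ioi 0, (ω r * (∫⁻ x in (Metric.ball 0 r)ᶜ, u x) ^ s) ^ θ.toReal := by
  have hθ' := ENNReal.toReal_nonneg (a := θ)
  have hθ0 := ENNReal.toReal_pos h0 hθ
  rw [← iUnion_dyadicSet hω, lintegral_iUnion measurableSet_dyadicSet pairwise_disjoint_dyadicSet]
  refine ENNReal.tsum_le_tsum fun k => ?_
  -- If `F` never exceeds `2^{k+1}`, the lower bound for the mass may fail, but then `E_{k+1}` is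
  -- everything and the term vanishes.
  by_cases hex : ∃ t, (2 : ℝ≥0∞) ^ (k + 1) < cumul θ ω t
  swap
  · have : (radialSub n θ ω (2 ^ (k + 1)))ᶜ = ∅ := by
      refine compl_empty_iff.2 (eq_univ_of_forall fun x => not_lt.1 fun h => hex ⟨_, h⟩)
    simp [this, hs, hθ0]
  obtain ⟨t, ht⟩ := hex
  calc _ ≤ (∫⁻ r in dyadicSet θ ω k, ω r ^ θ.toReal) *
        ((∫⁻ x in (radialSub n θ ω (2 ^ (k + 1)))ᶜ, u x) ^ s) ^ θ.toReal := by
        gcongr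
        rw [tsub_le_iff_right]
        have hsub : lowerSet θ ω (2 ^ (k + 1)) ⊆ dyadicSet θ ω k ∪ lowerSet θ ω (2 ^ k) :=
          fun r hr => (le_or_gt (cumul θ ω r) (2 ^ k)).elim (fun h => Or.inr ⟨hr.1, h⟩)
            fun h => Or.inl ⟨hr.1, h, hr.2⟩
        calc _ ≤ _ := le_lintegral_lowerSet h0 hθ hω ht
          _ ≤ _ := lintegral_mono_set hsub
          _ ≤ _ := lintegral_union_le _ _ _
          _ ≤ _ := by
            gcongr
            exact (unorm_le_iff h0 hθ).1 (unorm_lowerSet_le h0 _)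
    _ = ∫⁻ r in dyadicSet θ ω k, ω r ^ θ.toReal *
        ((∫⁻ x in (radialSub n θ ω (2 ^ (k + 1)))ᶜ, u x) ^ s) ^ θ.toReal :=
      (lintegral_mul_const'' _ ((hω.1.mono_set (dyadicSet_subset_Ioi k)).pow_const _)).symm
    _ ≤ _ := by
      refine setLIntegral_mono' (measurableSet_dyadicSet k) fun r hr => ?_
      rw [ENNReal.mul_rpow_of_nonneg _ _ hθ']
      gcongr
      exact ball_subset_radialSub hr.2.2

/-- For `r < t` the tail integral at `t` is at most that at `r`; it can be frozen while the
essential supremum of `ω` is taken over `(0,t)`. -/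
lemma cumul_mul_le_essSup_morrey (hs : 0 ≤ s) (t : ℝ) :
    cumul ∞ ω t * (∫⁻ x in (Metric.ball 0 t)ᶜ, u x) ^ s ≤
      unorm ∞ (Ioi 0) (fun r => ω r * (∫⁻ x in (Metric.ball 0 r)ᶜ, u x) ^ s) := by
  set X := unorm ∞ (Ioi 0) (fun r => ω r * (∫⁻ x in (Metric.ball 0 r)ᶜ, u x) ^ s) with hX
  set c := (∫⁻ x in (Metric.ball 0 t)ᶜ, u x) ^ s with hc
  by_cases hc0 : c = 0
  · simp [hc0]
  by_cases hXt : X = ∞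
  · simp [hXt]
  rw [← ENNReal.le_div_iff_mul_le (Or.inl hc0) (Or.inr hXt)]
  refine unorm_top_le_iff.2 ?_
  have h := ae_restrict_of_ae_restrict_of_subset (Ioo_subset_Ioi_self : Ioo 0 t ⊆ Ioi 0)
    (unorm_top_le_iff.1 hX.ge)
  filter_upwards [h, ae_restrict_mem measurableSet_Ioo] with r hr hrt
  rw [ENNReal.le_div_iff_mul_le (Or.inl hc0) (Or.inr hXt)]
  refine le_trans ?_ hr
  rw [hc]
  gcongr
  exact hrt.2.le

/-- For `θ = ∞` the function `F` may jump past `c` at the endpoint `a` of `{F ≤ c}`. Radii slightly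
larger than `a` do satisfy `F > c`, and the complements of those balls increase to the complement of
the closed ball. -/
lemma mul_le_essSup_morrey (hs : 0 < s) (c : ℝ≥0∞) :
    c * (∫⁻ x in (radialSub n ∞ ω c)ᶜ, u x) ^ s ≤
      unorm ∞ (Ioi 0) (fun r => ω r * (∫⁻ x in (Metric.ball 0 r)ᶜ, u x) ^ s) := by
  rcases radialSub_dichotomy (ω := ω) n ENNReal.top_ne_zero c with ⟨a, ha, h, hE⟩ | ⟨-, hE⟩
  swap
  · simp [hE, hs]
  set X := unorm ∞ (Ioi 0) (fun r => ω r * (∫⁻ x in (Metric.ball 0 r)ᶜ, u x) ^ s) with hX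
  by_cases hc0 : c = 0
  · simp [hc0]
  by_cases hXt : X = ∞
  · simp [hXt]
  have hU : (radialSub n ∞ ω c)ᶜ = ⋃ i : ℕ, (Metric.ball 0 (a + 1 / ((i : ℝ) + 1)))ᶜ := by
    rw [hE]
    ext x
    simp only [mem_compl_iff, mem_closedBall_zero_iff, mem_iUnion, mem_ball_zero_iff, not_le,
      not_lt]
    refine ⟨fun hx => ?_, fun ⟨i, hi⟩ => lt_of_lt_of_le (by
      have : (0:ℝ) < 1 / ((i : ℝ) + 1) := by positivity
      linarith) hi⟩
    obtain ⟨i, hi⟩ := exists_nat_one_div_lt (sub_pos.2 hx)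
    exact ⟨i, by linarith⟩
  have hmono : Monotone fun i : ℕ => (Metric.ball (0 : Rn n) (a + 1 / ((i : ℝ) + 1)))ᶜ :=
    fun i j hij => compl_subset_compl.2 (Metric.ball_subset_ball (by gcongr))
  rw [mul_comm, ← ENNReal.le_div_iff_mul_le (Or.inl hc0) (Or.inr hXt), hU,
    setLIntegral_iUnion_of_directed _ hmono.directed_le, ← inv_inv s,
    ENNReal.rpow_inv_le_iff (inv_pos.2 hs)]
  refine iSup_le fun i => ?_
  rw [← ENNReal.rpow_inv_le_iff (inv_pos.2 hs), inv_inv,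
    ENNReal.le_div_iff_mul_le (Or.inl hc0) (Or.inr hXt), mul_comm]
  refine le_trans ?_ (cumul_mul_le_essSup_morrey hs.le (a + 1 / ((i : ℝ) + 1)))
  gcongr
  refine (not_le.1 fun h' => ?_).le
  have : (0:ℝ) < 1 / ((i : ℝ) + 1) := by positivity
  linarith [(h _).1 h']

end Discretization

/-! ### Geometric series, discrete Hardy inequalities and sequence spaces -/

section Sequences

lemma two_rpow_add (x y : ℝ) : (2 : ℝ≥0∞) ^ (x + y) = 2 ^ x * 2 ^ y :=
  ENNReal.rpow_add _ _ two_ne_zero ENNReal.ofNat_ne_top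

lemma two_rpow_pos (x : ℝ) : 0 < (2 : ℝ≥0∞) ^ x :=
  ENNReal.rpow_pos two_pos ENNReal.ofNat_ne_top

lemma two_rpow_ne_top (x : ℝ) : (2 : ℝ≥0∞) ^ x ≠ ∞ :=
  ENNReal.rpow_ne_top_of_ne_zero two_ne_zero ENNReal.ofNat_ne_top

lemma two_zpow_eq (k : ℤ) : (2 : ℝ≥0∞) ^ k = 2 ^ (k : ℝ) := (ENNReal.rpow_intCast 2 k).symm

lemma two_zpow_rpow (k : ℤ) (e : ℝ) : ((2 : ℝ≥0∞) ^ k) ^ e = 2 ^ ((k : ℝ) * e) := by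
  rw [two_zpow_eq, ← ENNReal.rpow_mul]

/-- The sum of the geometric series with ratio `2 ^ (-e)`. -/
def geom (e : ℝ) : ℝ≥0∞ := ∑' i : ℕ, (2 : ℝ≥0∞) ^ (-(i * e))

lemma geom_eq (e : ℝ) : geom e = (1 - (2 : ℝ≥0∞) ^ (-e))⁻¹ := by
  have h : ∀ i : ℕ, (2 : ℝ≥0∞) ^ (-(i * e)) = (2 ^ (-e)) ^ i := fun i => by
    rw [← ENNReal.rpow_natCast, ← ENNReal.rpow_mul]
    ring_nf
  simp only [geom, h, ENNReal.tsum_geometric]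

lemma geom_ne_top {e : ℝ} (he : 0 < e) : geom e ≠ ∞ := by
  rw [geom_eq]
  refine ENNReal.inv_ne_top.2 (tsub_pos_of_lt ?_).ne'
  exact ENNReal.rpow_lt_one_of_one_lt_of_neg ENNReal.one_lt_two (neg_lt_zero.2 he)

lemma tsum_int_add (F : ℤ → ℝ≥0∞) (j : ℤ) : ∑' k, F (k + j) = ∑' k, F k :=
  (Equiv.addRight j).tsum_eq F

lemma tsum_int_neg (F : ℤ → ℝ≥0∞) : ∑' k, F (-k) = ∑' k, F k := (Equiv.neg ℤ).tsum_eq F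

lemma tsum_rpow_le {ι : Type*} {x : ι → ℝ≥0∞} {q : ℝ} (hq : 0 < q) (i : ι) :
    x i ≤ (∑' j, x j ^ q) ^ q⁻¹ := by
  rw [ENNReal.le_rpow_inv_iff hq]
  exact ENNReal.le_tsum (f := fun j => x j ^ q) i

/-- The weighted discrete Hardy inequality for geometric weights. -/
lemma discrete_hardy {e q : ℝ} (he : 0 < e) (hq : 0 < q) (a : ℤ → ℝ≥0∞) :
    ∑' k : ℤ, (2 : ℝ≥0∞) ^ ((k : ℝ) * e) * (∑' i : ℕ, a (k + i)) ^ q ≤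
      geom (e / (2 * q)) ^ q * geom (e / 2) * ∑' k : ℤ, (2 : ℝ≥0∞) ^ ((k : ℝ) * e) * a k ^ q := by
  -- Half of the geometric weight is spent on the inner sum, bounding each of its terms by an `ℓ_q`
  -- norm; the other half makes the outer sum converge. No distinction between `q < 1` and `q ≥ 1`
  -- is needed.
  set δ := e / (2 * q) with hδ
  have hδq : δ * q = e / 2 := by
    rw [hδ]
    field_simp
  have h1 : ∀ k : ℤ, (∑' i : ℕ, a (k + i)) ^ q ≤
      geom δ ^ q * ∑' i : ℕ, 2 ^ ((i : ℝ) * (e / 2)) * a (k + i) ^ q := fun k => by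
    set b : ℕ → ℝ≥0∞ := fun i => 2 ^ ((i : ℝ) * δ) * a (k + i) with hb
    have hbq : ∀ i, b i ^ q = 2 ^ ((i : ℝ) * (e / 2)) * a (k + i) ^ q := fun i => by
      rw [hb, ENNReal.mul_rpow_of_nonneg _ _ hq.le, ← ENNReal.rpow_mul, mul_assoc, hδq]
    simp_rw [← hbq]
    rw [← ENNReal.le_rpow_inv_iff hq, ENNReal.mul_rpow_of_nonneg _ _ (inv_nonneg.2 hq.le),
      ENNReal.rpow_rpow_inv hq.ne', geom, ← ENNReal.tsum_mul_right]
    refine ENNReal.tsum_le_tsum fun i => ?_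
    calc a (k + i) = 2 ^ (-((i : ℝ) * δ)) * b i := by
          rw [hb, ← mul_assoc, ← two_rpow_add, neg_add_cancel, ENNReal.rpow_zero, one_mul]
      _ ≤ _ := by
        gcongr
        exact tsum_rpow_le hq i
  calc _ ≤ ∑' k : ℤ, (2 : ℝ≥0∞) ^ ((k : ℝ) * e) *
        (geom δ ^ q * ∑' i : ℕ, 2 ^ ((i : ℝ) * (e / 2)) * a (k + i) ^ q) :=
        ENNReal.tsum_le_tsum fun k => mul_le_mul_right (h1 k) _
    _ = geom δ ^ q * ∑' i : ℕ, ∑' k : ℤ, 2 ^ (-((i : ℝ) * (e / 2))) *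
        (2 ^ (((k + i : ℤ) : ℝ) * e) * a (k + i) ^ q) := by
      rw [ENNReal.tsum_comm, ← ENNReal.tsum_mul_left]
      refine tsum_congr fun k => ?_
      rw [mul_left_comm, ← ENNReal.tsum_mul_left]
      congr 1
      refine tsum_congr fun i => ?_
      rw [← mul_assoc, ← mul_assoc, ← two_rpow_add, ← two_rpow_add]
      congr 2
      push_cast
      ring
    _ = _ := by
      simp_rw [ENNReal.tsum_mul_left]
      rw [mul_assoc]
      congr 1
      rw [geom, ← ENNReal.tsum_mul_right]
      refine tsum_congr fun i => ?_
      rw [tsum_int_add (fun k => (2 : ℝ≥0∞) ^ ((k : ℝ) * e) * a k ^ q) i]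

lemma discrete_hardy' {e q : ℝ} (he : 0 < e) (hq : 0 < q) (a : ℤ → ℝ≥0∞) :
    ∑' k : ℤ, (2 : ℝ≥0∞) ^ (-((k : ℝ) * e)) * (∑' i : ℕ, a (k - i)) ^ q ≤
      geom (e / (2 * q)) ^ q * geom (e / 2) *
        ∑' k : ℤ, (2 : ℝ≥0∞) ^ (-((k : ℝ) * e)) * a k ^ q := by
  have h := discrete_hardy he hq (fun k => a (-k))
  rw [← tsum_int_neg, ← tsum_int_neg fun k : ℤ => (2 : ℝ≥0∞) ^ (-((k : ℝ) * e)) * a k ^ q]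
  convert h using 6 with k k
  · push_cast
    ring
  · ring_nf
  · push_cast
    ring

lemma tsum_geometric_of_le {e : ℝ} (m : ℤ) :
    ∑' k : ℤ, {k : ℤ | m ≤ k}.indicator (fun k => (2 : ℝ≥0∞) ^ (-((k : ℝ) * e))) k =
      2 ^ (-((m : ℝ) * e)) * geom e := by
  have hinj : Function.Injective fun i : ℕ => m + (i : ℤ) := fun i j h => by simpa using h
  rw [← hinj.tsum_eq, geom, ← ENNReal.tsum_mul_left]
  · refine tsum_congr fun i => ?_
    rw [indicator_of_mem (by simp), ← two_rpow_add]
    push_cast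
    ring_nf
  · intro k hk
    have hmk : m ≤ k := by
      by_contra h
      exact hk (indicator_of_notMem (s := {k : ℤ | m ≤ k}) h _)
    exact ⟨(k - m).toNat, by simp [Int.toNat_of_nonneg (sub_nonneg.2 hmk)]⟩

/-- A bound on the terms bounds `K` from below, so the sum is dominated by a geometric series
starting near the size `B`; the factor `2 ^ e` pays for rounding `B ^ (1/e)` to a power of `2`. -/
lemma tsum_indicator_le {e : ℝ} (he : 0 < e) (K : Set ℤ) {B : ℝ≥0∞}
    (h : ∀ k ∈ K, (2 : ℝ≥0∞) ^ (-((k : ℝ) * e)) ≤ B) :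
    ∑' k : ℤ, K.indicator (fun k => (2 : ℝ≥0∞) ^ (-((k : ℝ) * e))) k ≤ geom e * 2 ^ e * B := by
  by_cases hB0 : B = 0
  · have hK : K = ∅ := eq_empty_of_forall_notMem fun k hk =>
      (two_rpow_pos _).not_ge ((h k hk).trans hB0.le)
    simp [hK]
  have hg0 : geom e ≠ 0 := fun h0 => by
    have := (ENNReal.le_tsum (f := fun i : ℕ => (2 : ℝ≥0∞) ^ (-(i * e))) 0).trans h0.le
    simp at this
  by_cases hBt : B = ∞
  · rw [hBt, ENNReal.mul_top (mul_ne_zero hg0 (two_rpow_pos e).ne')]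
    exact le_top
  obtain ⟨j, hj⟩ := exists_mem_Ioc_two_zpow (x := B ^ e⁻¹)
    (by simp [ENNReal.rpow_eq_zero_iff, hB0, hBt])
    (ENNReal.rpow_ne_top_of_nonneg (inv_nonneg.2 he.le) hBt)
  have hsub : K ⊆ {k : ℤ | -(j + 1) ≤ k} := fun k hk => by
    have h1 : (2 : ℝ≥0∞) ^ (-k : ℤ) ≤ 2 ^ (j + 1) := by
      refine le_trans ?_ hj.2
      rw [ENNReal.le_rpow_inv_iff he, two_zpow_rpow]
      refine le_trans (le_of_eq ?_) (h k hk)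
      push_cast
      ring_nf
    by_contra hlt
    have h2 : (2 : ℝ≥0∞) ^ (j + 1) < 2 ^ (-k : ℤ) := by
      rw [two_zpow_eq, two_zpow_eq]
      refine ENNReal.rpow_lt_rpow_of_exponent_lt ENNReal.one_lt_two ENNReal.ofNat_ne_top ?_
      have : j + 1 < -k := by
        simp only [mem_ofPred_eq] at hlt
        omega
      exact_mod_cast this
    exact h1.not_gt h2
  calc _ ≤ _ := ENNReal.tsum_le_tsum fun k =>
        indicator_le_indicator_of_subset hsub (fun _ => zero_le) k
    _ = 2 ^ (-(((-(j + 1) : ℤ) : ℝ) * e)) * geom e := tsum_geometric_of_le _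
    _ = geom e * 2 ^ e * ((2 : ℝ≥0∞) ^ j) ^ e := by
      rw [mul_comm, mul_assoc, two_zpow_rpow, ← two_rpow_add]
      push_cast
      ring_nf
    _ ≤ _ := by
      gcongr
      rw [← ENNReal.le_rpow_inv_iff he]
      exact hj.1.le

/-- The embedding `ℓ_q ⊂ ℓ_p`: in `x ^ p = x ^ q x ^ (p-q)` the last factor is bounded by the `ℓ_q`
norm. -/
lemma tsum_rpow_le_of_le {ι : Type*} (x : ι → ℝ≥0∞) {p q : ℝ} (hq : 0 < q) (hqp : q ≤ p) :
    ∑' i, x i ^ p ≤ (∑' i, x i ^ q) ^ (p / q) := by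
  set Y := ∑' i, x i ^ q with hY
  have hpq : 0 ≤ p - q := sub_nonneg.2 hqp
  calc ∑' i, x i ^ p ≤ ∑' i, x i ^ q * Y ^ ((p - q) / q) := by
        refine ENNReal.tsum_le_tsum fun i => ?_
        calc x i ^ p = x i ^ q * x i ^ (p - q) := by
              rw [← ENNReal.rpow_add_of_nonneg _ _ hq.le hpq, add_sub_cancel]
          _ ≤ x i ^ q * (Y ^ q⁻¹) ^ (p - q) := by
              gcongr
              exact tsum_rpow_le hq i
          _ = _ := by rw [← ENNReal.rpow_mul, inv_mul_eq_div]
    _ = Y ^ (1 : ℝ) * Y ^ ((p - q) / q) := by rw [ENNReal.tsum_mul_right, ENNReal.rpow_one]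
    _ = _ := by
      rw [← ENNReal.rpow_add_of_nonneg _ _ zero_le_one (div_nonneg hpq hq.le)]
      congr 1
      field_simp
      ring

lemma tsum_mul_le {x y : ℤ → ℝ≥0∞} {p q : ℝ} (hpq : p.HolderConjugate q) :
    ∑' i, x i * y i ≤ (∑' i, x i ^ p) ^ (1 / p) * (∑' i, y i ^ q) ^ (1 / q) := by
  have h := ENNReal.lintegral_mul_le_Lp_mul_Lq Measure.count hpq
    (measurable_of_countable x).aemeasurable (measurable_of_countable y).aemeasurable
  simpa only [lintegral_count, Pi.mul_apply] using h

end Sequences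

/-- The layer cake formula for functions with values in `[0,∞]`. -/
lemma lintegral_layercake {α : Type*} [MeasurableSpace α] (m : Measure α) [SFinite m]
    {f : α → ℝ≥0∞} (hf : Measurable f) :
    ∫⁻ x, f x ∂m = ∫⁻ l in Ioi (0 : ℝ), m {x | ENNReal.ofReal l < f x} := by
  have h1 : ∀ c : ℝ≥0∞,
      c = ∫⁻ l in Ioi (0 : ℝ), {l : ℝ | ENNReal.ofReal l < c}.indicator 1 l := fun c => by
    rw [lintegral_indicator_one (measurableSet_lt ENNReal.measurable_ofReal measurable_const),
      Measure.restrict_apply (measurableSet_lt ENNReal.measurable_ofReal measurable_const)]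
    by_cases hc : c = ∞
    · simp [hc]
    · have : {l : ℝ | ENNReal.ofReal l < c} ∩ Ioi 0 = Ioo 0 c.toReal := by
        ext l
        simp only [mem_inter_iff, mem_ofPred_eq, mem_Ioi, mem_Ioo]
        rw [and_comm, and_congr_right_iff]
        exact fun hl => ENNReal.ofReal_lt_iff_lt_toReal hl.le hc
      rw [this, Real.volume_Ioo, sub_zero, ENNReal.ofReal_toReal hc]
  have hms : MeasurableSet {z : α × ℝ | ENNReal.ofReal z.2 < f z.1} :=
    measurableSet_lt (ENNReal.measurable_ofReal.comp measurable_snd) (hf.comp measurable_fst)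
  calc ∫⁻ x, f x ∂m = ∫⁻ x, (∫⁻ l in Ioi (0 : ℝ),
        {z : α × ℝ | ENNReal.ofReal z.2 < f z.1}.indicator 1 (x, l)) ∂m :=
        lintegral_congr fun x => h1 (f x)
    _ = ∫⁻ l in Ioi (0 : ℝ), ∫⁻ x,
        {z : α × ℝ | ENNReal.ofReal z.2 < f z.1}.indicator 1 (x, l) ∂m :=
        lintegral_lintegral_swap (measurable_one.indicator hms).aemeasurable
    _ = _ := lintegral_congr fun l =>
        lintegral_indicator_one (s := {x | ENNReal.ofReal l < f x})
          (measurableSet_lt measurable_const hf)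

/-! ### Comparing the Stieltjes integral with the dyadic sum -/

section Stieltjes

variable {θ : ℝ≥0∞} {ω : ℝ → ℝ≥0∞} {r : ℝ}

lemma cumul_le_omegaRight (t : ℝ) : cumul θ ω t ≤ omegaRight θ ω t :=
  (monotone_unorm θ ω).le_rightLim le_rfl

lemma omegaRight_le_cumul {t s : ℝ} (h : t < s) : omegaRight θ ω t ≤ cumul θ ω s :=
  (monotone_unorm θ ω).rightLim_le h

lemma ennreal_rpow_neg_anti (hr : 0 ≤ r) {x y : ℝ≥0∞} (h : x ≤ y) : y ^ (-r) ≤ x ^ (-r) := by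
  rw [ENNReal.rpow_neg, ENNReal.rpow_neg]
  exact ENNReal.inv_le_inv.2 (ENNReal.rpow_le_rpow h hr)

lemma ofReal_neg_negPow (hr : 0 ≤ r) (hω : DualOmega θ ω) (t : Ioi (0 : ℝ)) :
    ENNReal.ofReal (-negPow θ ω r t) = omegaRight θ ω t ^ (-r) := by
  rw [negPow, neg_neg, ENNReal.ofReal_toReal]
  rw [ENNReal.rpow_neg]
  exact ENNReal.inv_ne_top.2 (ENNReal.rpow_pos_of_nonneg
    ((hω.2 t t.2).1.trans_le (cumul_le_omegaRight t)) hr).ne'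

lemma lebesgueStieltjes_Ioc {h : Ioi (0 : ℝ) → ℝ} (hh : Monotone h) (a b : Ioi (0 : ℝ)) :
    lebesgueStieltjes hh (Ioc a b) =
      ENNReal.ofReal (hh.stieltjesFunction b - hh.stieltjesFunction a) :=
  StieltjesFunction.measure_Ioc _ a b

lemma le_stieltjesFunction {h : Ioi (0 : ℝ) → ℝ} (hh : Monotone h) (t : Ioi (0 : ℝ)) :
    h t ≤ hh.stieltjesFunction t := hh.le_rightLim le_rfl

lemma stieltjesFunction_le {h : Ioi (0 : ℝ) → ℝ} (hh : Monotone h) {t s : Ioi (0 : ℝ)}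
    (hts : t < s) : hh.stieltjesFunction t ≤ h s := hh.rightLim_le hts

variable (hh : Monotone (negPow θ ω r))

lemma stieltjesFunction_nonpos (t : Ioi (0 : ℝ)) : hh.stieltjesFunction t ≤ 0 := by
  have hlt : t < ⟨t + 1, by have := t.2; simp only [mem_Ioi] at this ⊢; linarith⟩ :=
    Subtype.mk_lt_mk.2 (lt_add_one _)
  refine (stieltjesFunction_le hh hlt).trans ?_
  simp [negPow]

/-- The superlevel set is a half-line `(a,∞)`, exhausted by half-open intervals starting to the
right of `a`. Since the distribution function is non-positive, each has mass at most `F(t+)^{-r}` at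
a left endpoint `t`, where `F(t) > c`. -/
lemma lebesgueStieltjes_superlevel_le (h0 : θ ≠ 0) (hr : 0 < r) (hω : DualOmega θ ω)
    (c : ℝ≥0∞) : lebesgueStieltjes hh {t | c < cumul θ ω t} ≤ c ^ (-r) := by
  rcases cumul_dichotomy (ω := ω) h0 c with ⟨a, ha, h⟩ | h
  swap
  · simp [(h _).not_gt]
  have hpos : ∀ i : ℕ, a < a + 1 / ((i : ℝ) + 1) := fun i => by
    have : (0:ℝ) < 1 / ((i : ℝ) + 1) := by positivity
    linarith
  have hpos' : ∀ i : ℕ, (0 : ℝ) < (i : ℝ) + 1 := fun i => by positivity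
  set s : ℕ → Set (Ioi (0 : ℝ)) := fun i =>
    Ioc ⟨a + 1 / ((i : ℝ) + 1), ha.trans_lt (hpos i)⟩ ⟨(i : ℝ) + 1, hpos' i⟩ with hs
  have hU : {t : Ioi (0 : ℝ) | c < cumul θ ω t} ⊆ ⋃ i, s i := by
    intro t ht
    have hat : a < t := not_le.1 fun h' => ((h _).2 h').not_gt ht
    obtain ⟨i, hi⟩ := exists_nat_one_div_lt (sub_pos.2 hat)
    obtain ⟨j, hj⟩ := exists_nat_gt (t : ℝ)
    refine mem_iUnion.2 ⟨max i j, ?_, ?_⟩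
    · refine Subtype.mk_lt_mk.2 ?_
      have : 1 / (((max i j : ℕ) : ℝ) + 1) ≤ 1 / ((i : ℝ) + 1) :=
        one_div_le_one_div_of_le (hpos' i) (by gcongr; exact le_max_left _ _)
      linarith
    · refine Subtype.mk_le_mk.2 ?_
      have : (j : ℝ) ≤ ((max i j : ℕ) : ℝ) := by gcongr; exact le_max_right _ _
      linarith
  have hmono : Monotone s := fun i j hij =>
    Ioc_subset_Ioc (Subtype.mk_le_mk.2 (by gcongr)) (Subtype.mk_le_mk.2 (by gcongr))
  refine (measure_mono hU).trans ?_
  rw [hmono.measure_iUnion]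
  refine iSup_le fun i => ?_
  rw [hs, lebesgueStieltjes_Ioc]
  set t : Ioi (0 : ℝ) := ⟨a + 1 / ((i : ℝ) + 1), ha.trans_lt (hpos i)⟩ with ht
  have hct : c ≤ cumul θ ω t := (not_le.1 fun h' => (hpos i).not_ge ((h _).1 h')).le
  calc _ ≤ ENNReal.ofReal (-negPow θ ω r t) := by
        apply ENNReal.ofReal_le_ofReal
        linarith [stieltjesFunction_nonpos hh ⟨(i : ℝ) + 1, hpos' i⟩, le_stieltjesFunction hh t]
    _ = omegaRight θ ω t ^ (-r) := ofReal_neg_negPow hr.le hω t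
    _ ≤ c ^ (-r) := ennreal_rpow_neg_anti hr.le (hct.trans (cumul_le_omegaRight _))

lemma rpow_neg_le_lebesgueStieltjes (hr : 0 < r) (hω : DualOmega θ ω) {a s b : ℝ} (ha : 0 ≤ a)
    (has : a < s) (hb : 0 < b) :
    cumul θ ω s ^ (-r) ≤
      lebesgueStieltjes hh {t : Ioi (0 : ℝ) | a < t} + cumul θ ω b ^ (-r) := by
  -- Two intermediate points: one absorbs the right limit in the Stieltjes function, the other the
  -- right limit in `omegaRight`.
  obtain ⟨t, hat, hts⟩ := exists_between has
  obtain ⟨t', hat', hts'⟩ := exists_between hts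
  set T : Ioi (0 : ℝ) := ⟨t, ha.trans_lt hat⟩ with hT
  set T' : Ioi (0 : ℝ) := ⟨t', (ha.trans_lt hat).trans hat'⟩ with hT'
  set B : Ioi (0 : ℝ) := ⟨b, hb⟩ with hB
  calc cumul θ ω s ^ (-r) ≤ omegaRight θ ω T' ^ (-r) :=
        ennreal_rpow_neg_anti hr.le (omegaRight_le_cumul hts')
    _ = ENNReal.ofReal (-negPow θ ω r T') := (ofReal_neg_negPow hr.le hω T').symm
    _ ≤ ENNReal.ofReal ((hh.stieltjesFunction B - hh.stieltjesFunction T) +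
          -negPow θ ω r B) := by
        apply ENNReal.ofReal_le_ofReal
        linarith [le_stieltjesFunction hh B,
          stieltjesFunction_le hh (Subtype.mk_lt_mk.2 hat' : T < T')]
    _ ≤ ENNReal.ofReal (hh.stieltjesFunction B - hh.stieltjesFunction T) +
          ENNReal.ofReal (-negPow θ ω r B) := ENNReal.ofReal_add_le
    _ ≤ _ := by
      rw [← lebesgueStieltjes_Ioc, ofReal_neg_negPow hr.le hω B]
      refine add_le_add (measure_mono fun x hx => hat.trans hx.1) ?_
      exact ennreal_rpow_neg_anti hr.le (cumul_le_omegaRight _)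

lemma rpow_neg_le_lebesgueStieltjes_add (h0 : θ ≠ 0) (hr : 0 < r) (hω : DualOmega θ ω) {a s : ℝ}
    (ha : 0 ≤ a) (has : a < s) :
    cumul θ ω s ^ (-r) ≤
      lebesgueStieltjes hh {t : Ioi (0 : ℝ) | a < t} + unorm θ (Ioi 0) ω ^ (-r) := by
  set ν := lebesgueStieltjes hh {t : Ioi (0 : ℝ) | a < t} with hν
  by_cases hle : cumul θ ω s ^ (-r) ≤ ν
  · exact hle.trans le_self_add
  rw [← tsub_le_iff_left]
  set y := cumul θ ω s ^ (-r) - ν with hy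
  have hr' : 0 < r⁻¹ := inv_pos.2 hr
  -- The limit `b → ∞`: a lower bound for all `F(b)^{-r}` is an upper bound for all `F(b)`, hence
  -- for the norm over `(0,∞)`.
  have h1 : unorm θ (Ioi 0) ω ≤ y ^ (-r⁻¹) := unorm_Ioi_le h0 ω fun b hb => by
    have h2 : y ≤ cumul θ ω b ^ (-r) :=
      tsub_le_iff_left.2 (rpow_neg_le_lebesgueStieltjes hh hr hω ha has hb)
    refine le_of_eq_of_le ?_ (ennreal_rpow_neg_anti hr'.le h2)
    rw [← ENNReal.rpow_mul, neg_mul_neg, mul_inv_cancel₀ hr.ne', ENNReal.rpow_one]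
    rfl
  refine le_of_eq_of_le ?_ (ennreal_rpow_neg_anti hr.le h1)
  rw [← ENNReal.rpow_mul, neg_mul_neg, inv_mul_cancel₀ hr.ne', ENNReal.rpow_one]

variable {n : ℕ} {q : ℝ≥0∞} {g : Rn n → ℝ≥0∞}

/-- `∑_k (2 ^ (-k) ‖g‖_{q, E_{k+1}}) ^ r`, where `E_k` is the sublevel set
`‖ω‖_{θ,(0,|x|)} ≤ 2 ^ k`. -/
def dyadicSum (q θ : ℝ≥0∞) (ω : ℝ → ℝ≥0∞) (r : ℝ) (g : Rn n → ℝ≥0∞) : ℝ≥0∞ :=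
  ∑' k : ℤ, (2 : ℝ≥0∞) ^ (-((k : ℝ) * r)) * unorm q (radialSub n θ ω (2 ^ (k + 1))) g ^ r

lemma two_zpow_rpow_neg (k : ℤ) (r : ℝ) :
    ((2 : ℝ≥0∞) ^ k) ^ (-r) = 2 ^ (-((k : ℝ) * r)) := by rw [two_zpow_rpow, mul_neg]

lemma lintegral_lebesgueStieltjes_le (h0 : θ ≠ 0) (hr : 0 < r) (hω : DualOmega θ ω) :
    ∫⁻ t : Ioi (0 : ℝ), unorm q (Metric.ball 0 (t : ℝ)) g ^ r ∂lebesgueStieltjes hh ≤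
      dyadicSum q θ ω r g := by
  set I : ℤ → Set (Ioi (0 : ℝ)) := fun k => (↑) ⁻¹' dyadicSet θ ω k with hI
  have hU : ⋃ k, I k = univ := eq_univ_of_forall fun t => by
    have : (t : ℝ) ∈ ⋃ k, dyadicSet θ ω k := by
      rw [iUnion_dyadicSet hω]
      exact t.2
    simpa [hI] using this
  rw [← setLIntegral_univ, ← hU]
  refine (lintegral_iUnion_le _ _).trans (ENNReal.tsum_le_tsum fun k => ?_)
  calc _ ≤ ∫⁻ t in I k, unorm q (radialSub n θ ω (2 ^ (k + 1))) g ^ r ∂lebesgueStieltjes hh := by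
        refine setLIntegral_mono' (measurable_subtype_coe (measurableSet_dyadicSet k))
          fun t ht => ENNReal.rpow_le_rpow (unorm_mono _ ?_ _) hr.le
        exact ball_subset_radialSub ht.2.2
    _ = unorm q (radialSub n θ ω (2 ^ (k + 1))) g ^ r * lebesgueStieltjes hh (I k) :=
      setLIntegral_const _ _
    _ ≤ _ := by
      rw [mul_comm, ← two_zpow_rpow_neg]
      gcongr
      exact (measure_mono fun t ht => ht.2.1).trans
        (lebesgueStieltjes_superlevel_le hh h0 hr hω (2 ^ k))

/-- If `‖ω‖_{θ,(0,∞)}` is finite and lies in `(2^k, 2^{k+1}]`, then `E_{k+1}` is the whole space and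
the `k`-th term alone suffices. If it is infinite, the left side is `0`. -/
lemma inv_unorm_mul_le (hr : 0 < r) (hω : DualOmega θ ω) :
    ((unorm θ (Ioi 0) ω)⁻¹ * unorm q univ g) ^ r ≤ dyadicSum q θ ω r g := by
  by_cases ht : unorm θ (Ioi 0) ω = ∞
  · simp [ht, hr]
  have hpos : unorm θ (Ioi 0) ω ≠ 0 :=
    ((hω.2 1 one_pos).1.trans_le (unorm_mono θ Ioo_subset_Ioi_self ω)).ne'
  obtain ⟨k, hk⟩ := exists_mem_Ioc_two_zpow hpos ht
  have huniv : radialSub n θ ω (2 ^ (k + 1)) = univ := eq_univ_of_forall fun x =>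
    (unorm_mono θ Ioo_subset_Ioi_self ω).trans hk.2
  refine le_trans ?_ (ENNReal.le_tsum k)
  rw [huniv, ENNReal.mul_rpow_of_nonneg _ _ hr.le, ← two_zpow_rpow_neg, ENNReal.inv_rpow,
    ← ENNReal.rpow_neg]
  exact mul_le_mul_left (ennreal_rpow_neg_anti hr.le hk.1.le) _

lemma dyadicSum_eq : dyadicSum q θ ω r g = 2 ^ r *
    ∑' k : ℤ, (2 : ℝ≥0∞) ^ (-((k : ℝ) * r)) * unorm q (radialSub n θ ω (2 ^ k)) g ^ r := by
  rw [dyadicSum, ← tsum_int_add (fun k : ℤ => (2 : ℝ≥0∞) ^ (-((k : ℝ) * r)) *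
    unorm q (radialSub n θ ω (2 ^ k)) g ^ r) 1, ← ENNReal.tsum_mul_left]
  refine tsum_congr fun k => ?_
  rw [← mul_assoc, ← two_rpow_add]
  congr 2
  push_cast
  ring

/-- The comparison at a single height `l`: by `tsum_indicator_le` it suffices to bound each term
separately. The Stieltjes measure is that of a half-line `(a,∞)`, and the indicator is the atom at
infinity. -/
lemma tsum_indicator_le_lebesgueStieltjes (hn : 1 ≤ n) (h0 : θ ≠ 0) (hq : q ≠ 0) (hr : 0 < r)
    (hω : DualOmega θ ω) (l : ℝ≥0∞) :
    ∑' k : ℤ, {k : ℤ | l < unorm q (radialSub n θ ω (2 ^ k)) g ^ r}.indicator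
        (fun k => (2 : ℝ≥0∞) ^ (-((k : ℝ) * r))) k ≤
      geom r * 2 ^ r * (lebesgueStieltjes hh
          {t : Ioi (0 : ℝ) | l < unorm q (Metric.ball 0 (t : ℝ)) g ^ r} +
        {l | l < unorm q univ g ^ r}.indicator (fun _ => unorm θ (Ioi 0) ω ^ (-r)) l) := by
  refine tsum_indicator_le hr _ fun k hk => ?_
  have hk' : l < unorm q univ g ^ r :=
    lt_of_lt_of_le hk (ENNReal.rpow_le_rpow (unorm_mono q (subset_univ _) g) hr.le)
  rw [indicator_of_mem (s := {l | l < unorm q univ g ^ r}) hk']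
  have hiff : ∀ x : ℝ≥0∞, l < x ^ r ↔ l ^ r⁻¹ < x := fun x =>
    (ENNReal.rpow_inv_lt_iff hr).symm
  simp only [mem_ofPred_eq, hiff] at hk hk' ⊢
  have hz : unorm q (Metric.ball (0 : Rn n) 0) g = 0 := by
    rw [Metric.ball_zero, unorm_empty hq]
  rcases sublevel_dichotomy (F := fun t => unorm q (Metric.ball (0 : Rn n) t) g)
    (fun s t hst => unorm_mono q (Metric.ball_subset_ball hst) g) hz
    (fun t c h => unorm_ball_le hq g h) (l ^ r⁻¹) with ⟨a, ha, h⟩ | h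
  swap
  · exact absurd (unorm_univ_le hq g fun s _ => h s) hk'.not_ge
  have hset : {t : Ioi (0 : ℝ) | l ^ r⁻¹ < unorm q (Metric.ball 0 (t : ℝ)) g} =
      {t : Ioi (0 : ℝ) | a < t} := by
    ext t
    simp only [mem_ofPred_eq, ← not_le, h]
  rw [hset]
  -- Otherwise `E_k` would lie in the closed ball of radius `a`, where the norm of `g` does not
  -- exceed the height.
  obtain ⟨s, has, hs⟩ : ∃ s, a < s ∧ cumul θ ω s ≤ 2 ^ k := by
    by_contra hcon
    push Not at hcon
    refine hk.not_ge (le_trans (unorm_mono q (B := Metric.closedBall 0 a) ?_ g) ?_)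
    · exact fun x hx => mem_closedBall_zero_iff.2 (not_lt.1 fun h' => (hcon _ h').not_ge hx)
    · rw [unorm_congr_set q (closedBall_ae_eq_ball hn a)]
      exact (h a).2 le_rfl
  rw [← two_zpow_rpow_neg]
  exact (ennreal_rpow_neg_anti hr.le hs).trans
    (rpow_neg_le_lebesgueStieltjes_add hh h0 hr hω ha has)

/-- Both sides are layer cake integrals in the height, so the estimate at a fixed height is
integrated. -/
lemma dyadicSum_le_lebesgueStieltjes (hn : 1 ≤ n) (h0 : θ ≠ 0) (hq : q ≠ 0) (hr : 0 < r)
    (hω : DualOmega θ ω) :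
    dyadicSum q θ ω r g ≤ 2 ^ r * (geom r * 2 ^ r) *
      (∫⁻ t : Ioi (0 : ℝ), unorm q (Metric.ball 0 (t : ℝ)) g ^ r ∂lebesgueStieltjes hh +
        ((unorm θ (Ioi 0) ω)⁻¹ * unorm q univ g) ^ r) := by
  have hH : Measurable fun t : Ioi (0 : ℝ) => unorm q (Metric.ball (0 : Rn n) (t : ℝ)) g ^ r :=
    Monotone.measurable fun s t hst => ENNReal.rpow_le_rpow
      (unorm_mono q (Metric.ball_subset_ball hst) g) hr.le
  have hsf : SFinite (lebesgueStieltjes hh) := by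
    unfold lebesgueStieltjes
    infer_instance
  have hc : ∀ c : ℝ≥0∞, MeasurableSet {l : ℝ | ENNReal.ofReal l < c} := fun c =>
    measurableSet_lt ENNReal.measurable_ofReal measurable_const
  -- Layer cake on a one-point space, for a single term of weight `w`.
  have hlc : ∀ c w : ℝ≥0∞, w * c = ∫⁻ l in Ioi (0 : ℝ),
      {l | l < c}.indicator (fun _ => w) (ENNReal.ofReal l) := fun c w => by
    have h := lintegral_layercake (Measure.dirac ()) (f := fun _ => c) measurable_const
    rw [lintegral_const, Measure.dirac_apply_of_mem (mem_univ _), mul_one] at h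
    nth_rewrite 1 [h]
    rw [← lintegral_const_mul'' _ ?_]
    · refine lintegral_congr fun l => ?_
      by_cases hl : ENNReal.ofReal l < c <;> simp [hl]
    · refine Measurable.aemeasurable ?_
      have : (fun l : ℝ => Measure.dirac () {x : Unit | ENNReal.ofReal l < c}) =
          {l : ℝ | ENNReal.ofReal l < c}.indicator 1 := by
        ext l
        by_cases hl : ENNReal.ofReal l < c <;> simp [hl]
      rw [this]
      exact measurable_one.indicator (hc c)
  have hind : ∀ c w : ℝ≥0∞, Measurable fun l : ℝ =>
      {l | l < c}.indicator (fun _ => w) (ENNReal.ofReal l) := fun c w =>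
    (measurable_const.indicator measurableSet_Iio).comp ENNReal.measurable_ofReal
  rw [dyadicSum_eq, mul_assoc]
  gcongr
  calc _ = ∑' k : ℤ, ∫⁻ l in Ioi (0 : ℝ),
        {l | l < unorm q (radialSub n θ ω (2 ^ k)) g ^ r}.indicator
          (fun _ => (2 : ℝ≥0∞) ^ (-((k : ℝ) * r))) (ENNReal.ofReal l) :=
        tsum_congr fun k => hlc _ _
    _ = ∫⁻ l in Ioi (0 : ℝ), ∑' k : ℤ,
        {l | l < unorm q (radialSub n θ ω (2 ^ k)) g ^ r}.indicator
          (fun _ => (2 : ℝ≥0∞) ^ (-((k : ℝ) * r))) (ENNReal.ofReal l) :=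
        (lintegral_tsum fun k => (hind _ _).aemeasurable).symm
    _ ≤ ∫⁻ l in Ioi (0 : ℝ), geom r * 2 ^ r * (lebesgueStieltjes hh
          {t : Ioi (0 : ℝ) | ENNReal.ofReal l < unorm q (Metric.ball 0 (t : ℝ)) g ^ r} +
        {l | l < unorm q univ g ^ r}.indicator (fun _ => unorm θ (Ioi 0) ω ^ (-r))
          (ENNReal.ofReal l)) := by
      refine lintegral_mono fun l => ?_
      refine le_trans (le_of_eq (tsum_congr fun k => ?_))
        (tsum_indicator_le_lebesgueStieltjes hh hn h0 hq hr hω (ENNReal.ofReal l))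
      simp only [indicator, mem_ofPred_eq]
    _ = _ := by
      rw [lintegral_const_mul' _ _ (ENNReal.mul_ne_top (geom_ne_top hr) (two_rpow_ne_top r)),
        lintegral_add_right _ (hind _ _), ← hlc, ← lintegral_layercake _ hH,
        ENNReal.mul_rpow_of_nonneg _ _ hr.le, ENNReal.inv_rpow, ← ENNReal.rpow_neg]

end Stieltjes

/-! ### Admissible constants, annuli and upper bounds -/

section Embedding

variable {n : ℕ} {p₁ p₂ : ℝ} {θ : ℝ≥0∞} {ω : ℝ → ℝ≥0∞} {v₁ v₂ : Rn n → ℝ≥0∞}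

lemma wnorm_ofReal {p : ℝ} (hp : 0 < p) (A : Set (Rn n)) (v g : Rn n → ℝ≥0∞) :
    wnorm (ENNReal.ofReal p) A v g = (∫⁻ x in A, g x ^ p * v x) ^ (1 / p) := by
  simp [wnorm, ENNReal.toReal_ofReal hp.le]

lemma lebesgueNorm_ofReal {p : ℝ} (hp : 0 < p) (v : Rn n → ℝ≥0∞) (f : Rn n → ℝ) :
    lebesgueNorm (ENNReal.ofReal p) v f = (∫⁻ x, ‖f x‖ₑ ^ p * v x) ^ (1 / p) := by
  rw [lebesgueNorm, wnorm_ofReal hp, setLIntegral_univ]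

lemma dualMorreyNorm_ofReal {p : ℝ} (hp : 0 < p) (v : Rn n → ℝ≥0∞) (f : Rn n → ℝ) :
    dualMorreyNorm (ENNReal.ofReal p) θ ω v f = unorm θ (Ioi 0)
      (fun r => ω r * (∫⁻ x in (Metric.ball 0 r)ᶜ, ‖f x‖ₑ ^ p * v x) ^ (1 / p)) := by
  simp only [dualMorreyNorm, wnorm_ofReal hp]

lemma embeddingNorm_le {Q : ℝ≥0∞}
    (h : ∀ f : Rn n → ℝ, AEMeasurable f → lebesgueNorm (ENNReal.ofReal p₁) v₁ f ≤
      Q * dualMorreyNorm (ENNReal.ofReal p₂) θ ω v₂ f) :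
    embeddingNorm p₁ p₂ θ ω v₁ v₂ ≤ Q := by
  by_cases hQ : Q = ∞
  · simp [hQ]
  lift Q to ℝ≥0 using hQ
  exact iInf₂_le Q fun f hf =>
    ⟨⟨hf.1, (h f hf.1).trans_lt (ENNReal.mul_lt_top ENNReal.coe_lt_top hf.2.2)⟩, h f hf.1⟩

/-- `c` is an admissible constant of the embedding. -/
def IsEmbeddingConst (p₁ p₂ : ℝ) (θ : ℝ≥0∞) (ω : ℝ → ℝ≥0∞) (v₁ v₂ : Rn n → ℝ≥0∞) (c : ℝ≥0) :
    Prop :=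
  ∀ f ∈ dualMorreySpace (ENNReal.ofReal p₂) θ ω v₂,
    lebesgueNorm (ENNReal.ofReal p₁) v₁ f ≤ c * dualMorreyNorm (ENNReal.ofReal p₂) θ ω v₂ f

lemma le_mul_embeddingNorm {Q K : ℝ≥0∞} (hK0 : K ≠ 0) (hK : K ≠ ∞)
    (h : ∀ c : ℝ≥0, IsEmbeddingConst p₁ p₂ θ ω v₁ v₂ c → Q ≤ K * c) :
    Q ≤ K * embeddingNorm p₁ p₂ θ ω v₁ v₂ := by
  rw [← ENNReal.div_le_iff' hK0 hK]
  refine le_iInf₂ fun c hc => ?_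
  rw [ENNReal.div_le_iff' hK0 hK]
  exact h c fun f hf => (hc f hf).2

/-- The form in which the embedding is tested: global integrability supplies the finiteness of all
tails required for membership in the Morrey space. -/
lemma lintegral_le_of_isEmbeddingConst (hp₁ : 0 < p₁) (hp : p₁ ≤ p₂) {c : ℝ≥0}
    (hc : IsEmbeddingConst p₁ p₂ θ ω v₁ v₂ c) {f : Rn n → ℝ} (hf : AEMeasurable f)
    (hfin : ∫⁻ x, ‖f x‖ₑ ^ p₂ * v₂ x ≠ ∞) {X : ℝ≥0∞} (hX : X ≠ ∞)
    (hfX : dualMorreyNorm (ENNReal.ofReal p₂) θ ω v₂ f ≤ X) :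
    ∫⁻ x, ‖f x‖ₑ ^ p₁ * v₁ x ≤ (c * X) ^ p₁ := by
  have hp₂ := hp₁.trans_le hp
  have h := hc f ⟨hf, fun t _ => ?_, hfX.trans_lt hX.lt_top⟩
  · rw [lebesgueNorm_ofReal hp₁, one_div] at h
    rw [← ENNReal.rpow_inv_le_iff hp₁]
    exact h.trans (by gcongr)
  · rw [wnorm_ofReal hp₂]
    exact ENNReal.rpow_lt_top_of_nonneg (by positivity)
      ((setLIntegral_le_lintegral _ _).trans_lt hfin.lt_top).ne

/-! ### The annuli -/

/-- The points `x` with `2 ^ k < ‖ω‖_{θ,(0,|x|)} ≤ 2 ^ (k + 1)`. -/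
def annulus (n : ℕ) (θ : ℝ≥0∞) (ω : ℝ → ℝ≥0∞) (k : ℤ) : Set (Rn n) :=
  {x | cumul θ ω ‖x‖ ∈ Ioc ((2 : ℝ≥0∞) ^ k) (2 ^ (k + 1))}

lemma measurableSet_annulus (k : ℤ) : MeasurableSet (annulus n θ ω k) :=
  (measurable_cumul.comp measurable_norm) measurableSet_Ioc

lemma annulus_subset_radialSub {k j : ℤ} (h : k < j) :
    annulus n θ ω k ⊆ radialSub n θ ω (2 ^ j) := fun _ hx =>
  hx.2.trans (zpow_two_mono (Int.add_one_le_iff.2 h))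

lemma annulus_subset_compl (k : ℤ) : annulus n θ ω k ⊆ (radialSub n θ ω (2 ^ k))ᶜ :=
  fun _ hx => not_le.2 hx.1

lemma pairwise_disjoint_annulus : Pairwise (Function.onFun Disjoint (annulus n θ ω)) :=
  fun _ _ h => Set.disjoint_left.2 fun _ hx hx' =>
    Set.disjoint_left.1 (disjoint_Ioc_two_zpow h) hx hx'

lemma exists_mem_annulus (hω : DualOmega θ ω) {x : Rn n} (hx : x ≠ 0) :
    ∃ k, x ∈ annulus n θ ω k :=
  have h := hω.2 ‖x‖ (norm_pos_iff.2 hx)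
  exists_mem_Ioc_two_zpow h.1.ne' h.2.ne

lemma iUnion_annulus_ae (hn : 1 ≤ n) (hω : DualOmega θ ω) :
    ⋃ k, annulus n θ ω k =ᵐ[volume] (univ : Set (Rn n)) := by
  have := nontrivial_Rn hn
  refine Filter.eventuallyEq_univ.2 ?_
  filter_upwards [compl_mem_ae_iff.2 (measure_singleton (0 : Rn n))] with x hx
  exact mem_iUnion.2 (exists_mem_annulus hω hx)

lemma radialSub_ae_subset (hn : 1 ≤ n) (hω : DualOmega θ ω) (k : ℤ) :
    radialSub n θ ω (2 ^ (k + 1)) =ᵐ[volume]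
      (radialSub n θ ω (2 ^ (k + 1)) ∩ ⋃ i : ℕ, annulus n θ ω (k - i) : Set (Rn n)) := by
  have := nontrivial_Rn hn
  filter_upwards [compl_mem_ae_iff.2 (measure_singleton (0 : Rn n))] with x hx
  refine propext ⟨fun h => ⟨h, ?_⟩, fun h => h.1⟩
  obtain ⟨j, hj⟩ := exists_mem_annulus hω (θ := θ) (ω := ω) hx
  have hjk : j ≤ k := by
    by_contra hlt
    push Not at hlt
    exact ((zpow_two_mono (Int.add_one_le_iff.2 hlt)).trans_lt hj.1).not_ge h
  refine mem_iUnion.2 ⟨(k - j).toNat, ?_⟩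
  rwa [Int.toNat_of_nonneg (sub_nonneg.2 hjk), sub_sub_cancel]

/-- Countable subadditivity of a power of `ratioNorm`. -/
lemma exists_ratioNorm_iUnion_le (hp₁ : 0 < p₁) (hp : p₁ ≤ p₂) :
    ∃ σ : ℝ, 0 < σ ∧ ∀ (n : ℕ) (v₁ v₂ : Rn n → ℝ≥0∞) (B : ℕ → Set (Rn n)),
      ratioNorm p₁ p₂ v₁ v₂ (⋃ i, B i) ^ σ ≤ ∑' i, ratioNorm p₁ p₂ v₁ v₂ (B i) ^ σ := by
  rcases hp.eq_or_lt with rfl | hlt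
  -- For `p₁ = p₂` the norm is an essential supremum, and a supremum is at most the sum; otherwise
  -- `σ` is the exponent of the norm.
  · refine ⟨1, one_pos, fun n v₁ v₂ B => ?_⟩
    simp only [ratioNorm_of_eq hp₁, ENNReal.rpow_one]
    rw [unorm_top_le_iff, ae_restrict_iUnion_iff]
    intro i
    filter_upwards [unorm_top_le_iff.1 (le_refl (unorm ∞ (B i) (ratio p₁ p₁ v₁ v₂)))] with x hx
    exact hx.trans (ENNReal.le_tsum (f := fun i => unorm ∞ (B i) (ratio p₁ p₁ v₁ v₂)) i)
  · have hσ : 0 < p₁ * p₂ / (p₂ - p₁) :=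
      div_pos (mul_pos hp₁ (hp₁.trans hlt)) (sub_pos.2 hlt)
    refine ⟨_, hσ, fun n v₁ v₂ B => ?_⟩
    simp only [ratioNorm_of_lt hp₁ hlt, one_div]
    simp only [ENNReal.rpow_inv_rpow hσ.ne']
    exact lintegral_iUnion_le _ _

lemma ratioNorm_mono {A B : Set (Rn n)} (h : A ⊆ B) :
    ratioNorm p₁ p₂ v₁ v₂ A ≤ ratioNorm p₁ p₂ v₁ v₂ B := unorm_mono _ h _

/-! ### Upper bounds -/

lemma lintegral_le_tsum (hn : 1 ≤ n) (hp₁ : 0 < p₁) (hp : p₁ ≤ p₂) (hv₁ : IsWeight v₁)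
    (hv₂ : IsWeight v₂) (hω : DualOmega θ ω) {g : Rn n → ℝ≥0∞} (hg : AEMeasurable g) :
    ∫⁻ x, g x ^ p₁ * v₁ x ≤ ∑' k : ℤ, (ratioNorm p₁ p₂ v₁ v₂ (radialSub n θ ω (2 ^ (k + 1))) *
      (∫⁻ x in (radialSub n θ ω (2 ^ k))ᶜ, g x ^ p₂ * v₂ x) ^ (1 / p₂)) ^ p₁ := by
  rw [← setLIntegral_univ, ← setLIntegral_congr (iUnion_annulus_ae hn hω)]
  refine (lintegral_iUnion_le _ _).trans (ENNReal.tsum_le_tsum fun k => ?_)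
  refine (lintegral_le_ratioNorm_mul hp₁ hp hv₁ hv₂ _ hg).trans ?_
  rw [ENNReal.mul_rpow_of_nonneg _ _ hp₁.le, ← ENNReal.rpow_mul, one_div_mul_eq_div]
  have h1 := ratioNorm_mono (p₁ := p₁) (p₂ := p₂) (v₁ := v₁) (v₂ := v₂)
    (annulus_subset_radialSub (n := n) (θ := θ) (ω := ω) (lt_add_one k))
  have hp₂ := hp₁.trans_le hp
  gcongr
  exact annulus_subset_compl k

/-- The difference of consecutive powers is `2^{(k+1)θ} (1 - 2^{-θ})`, and `1 - 2^{-θ}` is the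
inverse of `geom θ`. -/
lemma tsum_le_dualMorreyNorm (h0 : θ ≠ 0) (hθ : θ ≠ ∞) (hω : DualOmega θ ω) {s : ℝ} (hs : 0 < s)
    (u : Rn n → ℝ≥0∞) :
    ∑' k : ℤ, ((2 : ℝ≥0∞) ^ k * (∫⁻ x in (radialSub n θ ω (2 ^ k))ᶜ, u x) ^ s) ^ θ.toReal ≤
      geom θ.toReal * unorm θ (Ioi 0)
        (fun r => ω r * (∫⁻ x in (Metric.ball 0 r)ᶜ, u x) ^ s) ^ θ.toReal := by
  have hθ0 := ENNReal.toReal_pos h0 hθ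
  have h := tsum_le_lintegral_morrey h0 hθ hω hs (u := u)
  rw [unorm_rpow h0 hθ]
  refine le_trans ?_ (mul_le_mul_right h _)
  rw [← tsum_int_add (fun k : ℤ =>
    ((2 : ℝ≥0∞) ^ k * (∫⁻ x in (radialSub n θ ω (2 ^ k))ᶜ, u x) ^ s) ^ θ.toReal) 1,
    ← ENNReal.tsum_mul_left]
  refine ENNReal.tsum_le_tsum fun k => ?_
  rw [ENNReal.mul_rpow_of_nonneg _ _ hθ0.le, ← mul_assoc]
  refine mul_le_mul_left (le_of_eq ?_) _
  have h1 : ((2 : ℝ≥0∞) ^ k) ^ θ.toReal =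
      ((2 : ℝ≥0∞) ^ (k + 1)) ^ θ.toReal * 2 ^ (-θ.toReal) := by
    rw [two_zpow_rpow, two_zpow_rpow, ← two_rpow_add]
    push_cast
    ring_nf
  have hlt : (2 : ℝ≥0∞) ^ (-θ.toReal) < 1 :=
    ENNReal.rpow_lt_one_of_one_lt_of_neg ENNReal.one_lt_two (neg_lt_zero.2 hθ0)
  have h2 : ((2 : ℝ≥0∞) ^ (k + 1)) ^ θ.toReal - ((2 : ℝ≥0∞) ^ k) ^ θ.toReal =
      ((2 : ℝ≥0∞) ^ (k + 1)) ^ θ.toReal * (1 - 2 ^ (-θ.toReal)) := by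
    rw [h1, ENNReal.mul_sub (fun _ _ => by rw [two_zpow_rpow]; exact two_rpow_ne_top _), mul_one]
  rw [h2, geom_eq, mul_left_comm, ENNReal.inv_mul_cancel (tsub_pos_of_lt hlt).ne'
    (ENNReal.sub_ne_top ENNReal.one_ne_top), mul_one]

lemma ratioNorm_radialSub_le (hn : 1 ≤ n) (h0 : θ ≠ 0) (hp₁ : 0 < p₁) (hp : p₁ ≤ p₂)
    {S : ℝ≥0∞} (hS : ∀ t, 0 < t → ratioNorm p₁ p₂ v₁ v₂ (Metric.ball 0 t) ≤ S * cumul θ ω t)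
    (c : ℝ≥0∞) : ratioNorm p₁ p₂ v₁ v₂ (radialSub n θ ω c) ≤ S * c := by
  rcases radialSub_dichotomy (ω := ω) n h0 c with ⟨a, ha, h, hE⟩ | ⟨h, hE⟩
  · rw [hE, ratioNorm_eq_unorm, unorm_congr_set _ (closedBall_ae_eq_ball hn a),
      ← ratioNorm_eq_unorm]
    rcases ha.eq_or_lt with rfl | ha
    · rw [Metric.ball_zero, ratioNorm_eq_unorm, unorm_empty (ratioExp_ne_zero hp₁ hp)]
      exact zero_le
    · exact (hS a ha).trans (mul_le_mul_right ((h a).2 le_rfl) _)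
  · rw [hE]
    exact unorm_univ_le (ratioExp_ne_zero hp₁ hp) _ fun s hs =>
      (hS s hs).trans (mul_le_mul_right (h s) _)

lemma ratioNorm_ball_le_supQuantity (hω : DualOmega θ ω) {t : ℝ} (ht : 0 < t) :
    ratioNorm p₁ p₂ v₁ v₂ (Metric.ball 0 t) ≤ supQuantity p₁ p₂ θ ω v₁ v₂ * cumul θ ω t := by
  have h : (cumul θ ω t)⁻¹ * ratioNorm p₁ p₂ v₁ v₂ (Metric.ball 0 t) ≤
      supQuantity p₁ p₂ θ ω v₁ v₂ := le_iSup₂ (f := fun (t : ℝ) (_ : 0 < t) =>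
        (unorm θ (Ioo 0 t) ω)⁻¹ * ratioNorm p₁ p₂ v₁ v₂ (Metric.ball 0 t)) t ht
  have h' : 0 < cumul θ ω t ∧ cumul θ ω t < ∞ := hω.2 t ht
  rwa [mul_comm, ← div_eq_mul_inv, ENNReal.div_le_iff h'.1.ne' h'.2.ne] at h

lemma lebesgueNorm_le_supQuantity (hn : 1 ≤ n) (hp₁ : 0 < p₁) (hp : p₁ ≤ p₂) (hθ0 : θ ≠ 0)
    (hθ : θ ≤ ENNReal.ofReal p₁) (hv₁ : IsWeight v₁) (hv₂ : IsWeight v₂) (hω : DualOmega θ ω)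
    {f : Rn n → ℝ} (hf : AEMeasurable f) :
    lebesgueNorm (ENNReal.ofReal p₁) v₁ f ≤
      2 * geom θ.toReal ^ (1 / θ.toReal) * supQuantity p₁ p₂ θ ω v₁ v₂ *
        dualMorreyNorm (ENNReal.ofReal p₂) θ ω v₂ f := by
  have hp₂ := hp₁.trans_le hp
  have hθt : θ ≠ ∞ := (hθ.trans_lt ENNReal.ofReal_lt_top).ne
  have hτ := ENNReal.toReal_pos hθ0 hθt
  have hτp : θ.toReal ≤ p₁ := ENNReal.toReal_le_of_le_ofReal hp₁.le hθ
  set S := supQuantity p₁ p₂ θ ω v₁ v₂ with hS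
  set u : Rn n → ℝ≥0∞ := fun x => ‖f x‖ₑ ^ p₂ * v₂ x with hu
  rw [lebesgueNorm_ofReal hp₁, dualMorreyNorm_ofReal hp₂, one_div p₁,
    ENNReal.rpow_inv_le_iff hp₁]
  refine (lintegral_le_tsum hn hp₁ hp hv₁ hv₂ hω hf.enorm).trans ?_
  refine (tsum_rpow_le_of_le _ hτ hτp).trans ?_
  rw [div_eq_mul_inv p₁, mul_comm p₁, ENNReal.rpow_mul]
  refine ENNReal.rpow_le_rpow ?_ hp₁.le
  have hD := tsum_le_dualMorreyNorm hθ0 hθt hω (one_div_pos.2 hp₂) u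
  rw [ENNReal.rpow_inv_le_iff hτ]
  calc _ ≤ ∑' k : ℤ, (2 * S) ^ θ.toReal * ((2 : ℝ≥0∞) ^ k *
        (∫⁻ x in (radialSub n θ ω (2 ^ k))ᶜ, u x) ^ (1 / p₂)) ^ θ.toReal := by
        refine ENNReal.tsum_le_tsum fun k => ?_
        rw [← ENNReal.mul_rpow_of_nonneg _ _ hτ.le]
        refine ENNReal.rpow_le_rpow ?_ hτ.le
        rw [← mul_assoc]
        refine mul_le_mul_left ?_ _
        refine (ratioNorm_radialSub_le hn hθ0 hp₁ hp
          (fun t ht => ratioNorm_ball_le_supQuantity hω ht) _).trans_eq ?_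
        rw [ENNReal.zpow_add two_ne_zero ENNReal.ofNat_ne_top, zpow_one]
        ring
    _ ≤ (2 * S) ^ θ.toReal * (geom θ.toReal * unorm θ (Ioi 0)
        (fun r => ω r * (∫⁻ x in (Metric.ball 0 r)ᶜ, u x) ^ (1 / p₂)) ^ θ.toReal) := by
      rw [ENNReal.tsum_mul_left]
      exact mul_le_mul_right hD _
    _ = _ := by
      simp only [ENNReal.mul_rpow_of_nonneg _ _ hτ.le, ← ENNReal.rpow_mul,
        one_div_mul_cancel hτ.ne', ENNReal.rpow_one]
      ring

lemma stieltjesExp_pos (hp₁ : 0 < p₁) (hθ : ENNReal.ofReal p₁ < θ) : 0 < stieltjesExp p₁ θ := by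
  unfold stieltjesExp
  split_ifs with h
  · exact hp₁
  · have : p₁ < θ.toReal := (ENNReal.ofReal_lt_iff_lt_toReal hp₁.le h).1 hθ
    exact div_pos (mul_pos hp₁ (hp₁.trans this)) (sub_pos.2 this)

/-- `dyadicSum` for the quotient of weights and the exponents of the embedding. -/
def ratioSum (p₁ p₂ : ℝ) (θ : ℝ≥0∞) (ω : ℝ → ℝ≥0∞) (v₁ v₂ : Rn n → ℝ≥0∞) : ℝ≥0∞ :=
  dyadicSum (ENNReal.ofReal (p₁ * p₂) / ENNReal.ofReal (p₂ - p₁)) θ ω (stieltjesExp p₁ θ)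
    (ratio p₁ p₂ v₁ v₂)

lemma ratioSum_eq : ratioSum p₁ p₂ θ ω v₁ v₂ = ∑' k : ℤ,
    (2 : ℝ≥0∞) ^ (-((k : ℝ) * stieltjesExp p₁ θ)) *
      ratioNorm p₁ p₂ v₁ v₂ (radialSub n θ ω (2 ^ (k + 1))) ^ stieltjesExp p₁ θ := rfl

lemma lebesgueNorm_le_ratioSum_top (hn : 1 ≤ n) (hp₁ : 0 < p₁) (hp : p₁ ≤ p₂)
    (hv₁ : IsWeight v₁) (hv₂ : IsWeight v₂) (hω : DualOmega ∞ ω)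
    {f : Rn n → ℝ} (hf : AEMeasurable f) :
    lebesgueNorm (ENNReal.ofReal p₁) v₁ f ≤
      ratioSum p₁ p₂ ∞ ω v₁ v₂ ^ (1 / stieltjesExp p₁ ∞) *
        dualMorreyNorm (ENNReal.ofReal p₂) ∞ ω v₂ f := by
  have hp₂ := hp₁.trans_le hp
  rw [lebesgueNorm_ofReal hp₁, dualMorreyNorm_ofReal hp₂, one_div p₁,
    ENNReal.rpow_inv_le_iff hp₁, ratioSum_eq, stieltjesExp, if_pos rfl,
    ENNReal.mul_rpow_of_nonneg _ _ hp₁.le, ← ENNReal.rpow_mul, one_div_mul_cancel hp₁.ne',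
    ENNReal.rpow_one, ← ENNReal.tsum_mul_right]
  refine (lintegral_le_tsum hn hp₁ hp hv₁ hv₂ hω hf.enorm).trans
    (ENNReal.tsum_le_tsum fun k => ?_)
  have h := mul_le_essSup_morrey (ω := ω) (one_div_pos.2 hp₂) (2 ^ k)
    (u := fun x => ‖f x‖ₑ ^ p₂ * v₂ x)
  refine le_trans (le_of_eq ?_) (mul_le_mul_right (ENNReal.rpow_le_rpow h hp₁.le) _)
  rw [ENNReal.mul_rpow_of_nonneg _ _ hp₁.le, ENNReal.mul_rpow_of_nonneg _ _ hp₁.le,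
    two_zpow_rpow, mul_mul_mul_comm, ← two_rpow_add, neg_add_cancel, ENNReal.rpow_zero, one_mul]

lemma lebesgueNorm_le_ratioSum (hn : 1 ≤ n) (hp₁ : 0 < p₁) (hp : p₁ ≤ p₂)
    (hθ : ENNReal.ofReal p₁ < θ) (hθt : θ ≠ ∞) (hv₁ : IsWeight v₁) (hv₂ : IsWeight v₂)
    (hω : DualOmega θ ω) {f : Rn n → ℝ} (hf : AEMeasurable f) :
    lebesgueNorm (ENNReal.ofReal p₁) v₁ f ≤
      geom θ.toReal ^ (1 / θ.toReal) * ratioSum p₁ p₂ θ ω v₁ v₂ ^ (1 / stieltjesExp p₁ θ) *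
        dualMorreyNorm (ENNReal.ofReal p₂) θ ω v₂ f := by
  have hp₂ := hp₁.trans_le hp
  have hθ0 : θ ≠ 0 := (zero_le.trans_lt hθ).ne'
  have hτ := ENNReal.toReal_pos hθ0 hθt
  have hpτ : p₁ < θ.toReal := (ENNReal.ofReal_lt_iff_lt_toReal hp₁.le hθt).1 hθ
  set r := stieltjesExp p₁ θ with hr
  have hr0 : 0 < r := stieltjesExp_pos hp₁ hθ
  have hre : r = p₁ * θ.toReal / (θ.toReal - p₁) := by rw [hr, stieltjesExp, if_neg hθt]
  have hsub : 0 < θ.toReal - p₁ := sub_pos.2 hpτ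
  -- This is `1/p₁ = 1/r + 1/θ`; Hölder pairs `2^{-k} W(E_{k+1})` with `2^k` times the tail norm of
  -- `f`.
  have hconj : (r / p₁).HolderConjugate (θ.toReal / p₁) := by
    rw [Real.holderConjugate_iff, hre]
    refine ⟨?_, ?_⟩
    · rw [mul_div_assoc, mul_div_cancel_left₀ _ hp₁.ne', one_lt_div hsub]
      linarith
    · field_simp
      ring
  set u : Rn n → ℝ≥0∞ := fun x => ‖f x‖ₑ ^ p₂ * v₂ x with hu
  have hD := tsum_le_dualMorreyNorm hθ0 hθt hω (one_div_pos.2 hp₂) u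
  rw [lebesgueNorm_ofReal hp₁, dualMorreyNorm_ofReal hp₂, one_div p₁,
    ENNReal.rpow_inv_le_iff hp₁]
  refine (lintegral_le_tsum hn hp₁ hp hv₁ hv₂ hω hf.enorm).trans ?_
  set x : ℤ → ℝ≥0∞ := fun k => ((2 : ℝ≥0∞) ^ (-(k : ℝ)) *
    ratioNorm p₁ p₂ v₁ v₂ (radialSub n θ ω (2 ^ (k + 1)))) ^ p₁ with hx
  set y : ℤ → ℝ≥0∞ := fun k => ((2 : ℝ≥0∞) ^ k *
    (∫⁻ x in (radialSub n θ ω (2 ^ k))ᶜ, u x) ^ (1 / p₂)) ^ p₁ with hy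
  calc _ = ∑' k, x k * y k := by
        refine tsum_congr fun k => ?_
        rw [hx, hy, ← ENNReal.mul_rpow_of_nonneg _ _ hp₁.le, mul_mul_mul_comm,
          two_zpow_eq k, ← two_rpow_add, neg_add_cancel, ENNReal.rpow_zero, one_mul]
    _ ≤ _ := tsum_mul_le hconj
    _ ≤ ratioSum p₁ p₂ θ ω v₁ v₂ ^ (1 / (r / p₁)) * (geom θ.toReal * unorm θ (Ioi 0)
        (fun r => ω r * (∫⁻ x in (Metric.ball 0 r)ᶜ, u x) ^ (1 / p₂)) ^ θ.toReal) ^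
          (1 / (θ.toReal / p₁)) := by
      refine mul_le_mul' (le_of_eq ?_) (ENNReal.rpow_le_rpow (le_trans (le_of_eq ?_) hD) ?_)
      · congr 1
        rw [ratioSum_eq]
        refine tsum_congr fun k => ?_
        rw [hx, ← ENNReal.rpow_mul, mul_div_cancel₀ _ hp₁.ne',
          ENNReal.mul_rpow_of_nonneg _ _ hr0.le, ← ENNReal.rpow_mul, neg_mul]
      · refine tsum_congr fun k => ?_
        rw [hy, ← ENNReal.rpow_mul, mul_div_cancel₀ _ hp₁.ne']
      · positivity
    _ = _ := by
      rw [ENNReal.mul_rpow_of_nonneg _ _ (by positivity)]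
      simp only [ENNReal.mul_rpow_of_nonneg _ _ hp₁.le, ← ENNReal.rpow_mul]
      have e1 : 1 / (r / p₁) = 1 / r * p₁ := by field_simp
      have e2 : 1 / (θ.toReal / p₁) = 1 / θ.toReal * p₁ := by field_simp
      have e3 : θ.toReal * (1 / θ.toReal * p₁) = p₁ := by field_simp
      rw [e1, e2, e3]
      ring

end Embedding

/-! ### Lower bounds from test functions -/

section Lower

variable {n : ℕ} {p₁ p₂ : ℝ} {θ : ℝ≥0∞} {ω : ℝ → ℝ≥0∞} {v₁ v₂ : Rn n → ℝ≥0∞}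

lemma unorm_le_of_le_indicator {α : Type*} [MeasureSpace α] {p : ℝ≥0∞} (h0 : p ≠ 0)
    {A B : Set α} (hA : MeasurableSet A) (hB : MeasurableSet B) {F g : α → ℝ≥0∞}
    (h : ∀ x ∈ A, F x ≤ B.indicator g x) : unorm p A F ≤ unorm p B g := by
  by_cases hp : p = ∞
  · subst hp
    rw [unorm_top_le_iff, ae_restrict_iff' hA]
    have h1 := (ae_restrict_iff' hB).1 (unorm_top_le_iff.1 (le_refl (unorm ∞ B g)))
    refine h1.mono fun x hx hxA => (h x hxA).trans ?_
    by_cases hxB : x ∈ B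
    · simpa [hxB] using hx hxB
    · simp [hxB]
  · rw [unorm_le_iff h0 hp, unorm_rpow h0 hp]
    have hp0 := ENNReal.toReal_pos h0 hp
    calc _ ≤ ∫⁻ x in A, B.indicator (fun x => g x ^ p.toReal) x := by
          refine setLIntegral_mono' hA fun x hx =>
            (ENNReal.rpow_le_rpow (h x hx) hp0.le).trans_eq ?_
          by_cases hxB : x ∈ B <;> simp [hxB, hp0]
      _ = ∫⁻ x in B ∩ A, g x ^ p.toReal := by
          rw [lintegral_indicator hB, Measure.restrict_restrict hB]
      _ ≤ _ := lintegral_mono_set inter_subset_left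

/-- A near-extremal supported in `B(0,t)` has tail norm at most `1` for `r < t` and `0` for `r ≥ t`,
so its Morrey norm is at most `F(t)`. -/
lemma ratioNorm_ball_le_of_isEmbeddingConst (hp₁ : 0 < p₁) (hp : p₁ ≤ p₂) (h0 : θ ≠ 0)
    (hv₁ : IsWeight v₁) (hv₂ : IsWeight v₂) (hω : DualOmega θ ω) {c : ℝ≥0}
    (hc : IsEmbeddingConst p₁ p₂ θ ω v₁ v₂ c) {t : ℝ} (ht : 0 < t) :
    ratioNorm p₁ p₂ v₁ v₂ (Metric.ball 0 t) ≤ c * cumul θ ω t := by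
  have hp₂ := hp₁.trans_le hp
  refine le_of_forall_lt fun l hl => ?_
  obtain ⟨l', hll', hl'⟩ := exists_between hl
  refine hll'.trans_le ?_
  obtain ⟨f, hf, hsupp, h2, h1⟩ := exists_extremal hp₁ hp hv₁ hv₂ measurableSet_ball hl'
  rw [← ENNReal.rpow_le_rpow_iff hp₁]
  refine h1.trans (lintegral_le_of_isEmbeddingConst hp₁ hp hc hf
    (h2.trans_lt ENNReal.one_lt_top).ne (hω.2 t ht).2.ne ?_)
  rw [dualMorreyNorm_ofReal hp₂]
  refine unorm_le_of_le_indicator h0 measurableSet_Ioi measurableSet_Ioo fun r hr => ?_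
  by_cases hrt : r < t
  · rw [indicator_of_mem (show r ∈ Ioo 0 t from ⟨hr, hrt⟩)]
    refine mul_le_of_le_one_right' (ENNReal.rpow_le_one ?_ (by positivity))
    exact (setLIntegral_le_lintegral _ _).trans h2
  · have hz : ∫⁻ x in (Metric.ball 0 r)ᶜ, ‖f x‖ₑ ^ p₂ * v₂ x = 0 := by
      rw [setLIntegral_congr_fun (g := fun _ => 0) measurableSet_ball.compl]
      · simp
      · intro x hx
        have : f x = 0 := hsupp x fun h => hx (Metric.ball_subset_ball (not_lt.1 hrt) h)
        simp [this, hp₂]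
    simp [hz, hp₂]

/-- A linear combination, with coefficients `b k`, of extremal functions for Hölder's inequality on
the annuli. -/
lemma exists_combination (hp₁ : 0 < p₁) (hp : p₁ ≤ p₂)
    (hv₁ : IsWeight v₁) (hv₂ : IsWeight v₂)
    (hfin : ∀ k, ratioNorm p₁ p₂ v₁ v₂ (annulus n θ ω k) ≠ ∞) (F : Finset ℤ) {b : ℤ → ℝ≥0∞}
    (hb : ∀ k, b k ≠ ∞) :
    ∃ f : Rn n → ℝ, AEMeasurable f ∧ ∫⁻ x, ‖f x‖ₑ ^ p₂ * v₂ x ≠ ∞ ∧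
      (∀ k, ∫⁻ x in (radialSub n θ ω (2 ^ k))ᶜ, ‖f x‖ₑ ^ p₂ * v₂ x ≤
        ∑' i : ℕ, (F : Set ℤ).indicator (fun k => b k ^ p₂) (k + i)) ∧
      ∑ k ∈ F, b k ^ p₁ * (ratioNorm p₁ p₂ v₁ v₂ (annulus n θ ω k) / 2) ^ p₁ ≤
        ∫⁻ x, ‖f x‖ₑ ^ p₁ * v₁ x := by
  have hp₂ := hp₁.trans_le hp
  set w : ℤ → ℝ≥0∞ := fun k => ratioNorm p₁ p₂ v₁ v₂ (annulus n θ ω k) with hw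
  have hex : ∀ k, ∃ f : Rn n → ℝ, AEMeasurable f ∧ (∀ x, x ∉ annulus n θ ω k → f x = 0) ∧
      ∫⁻ x, ‖f x‖ₑ ^ p₂ * v₂ x ≤ 1 ∧ (w k / 2) ^ p₁ ≤ ∫⁻ x, ‖f x‖ₑ ^ p₁ * v₁ x := fun k => by
    by_cases hk : w k = 0
    · exact ⟨fun _ => 0, aemeasurable_const, fun _ _ => rfl, by simp [hp₂], by simp [hk, hp₁]⟩
    · exact exists_extremal hp₁ hp hv₁ hv₂ (measurableSet_annulus k)
        (ENNReal.half_lt_self hk (hfin k))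
  choose φ hφm hφs hφ2 hφ1 using hex
  have hterm : ∀ k x, ‖(b k).toReal * φ k x‖ₑ = b k * ‖φ k x‖ₑ := fun k x => by
    rw [enorm_mul, Real.enorm_eq_ofReal ENNReal.toReal_nonneg, ENNReal.ofReal_toReal (hb k)]
  -- The supports lie in disjoint annuli, so at most one summand is non-zero at each point and
  -- powers pass through the sum.
  have hpow : ∀ p : ℝ, 0 < p → ∀ x, ‖∑ k ∈ F, (b k).toReal * φ k x‖ₑ ^ p =
      ∑ k ∈ F, b k ^ p * ‖φ k x‖ₑ ^ p := fun p hp0 x => by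
    by_cases hj : ∃ j ∈ F, x ∈ annulus n θ ω j
    · obtain ⟨j, hjF, hj⟩ := hj
      have hz : ∀ k ∈ F, k ≠ j → φ k x = 0 := fun k _ hkj => hφs k x fun hk =>
        Set.disjoint_left.1 (pairwise_disjoint_annulus hkj) hk hj
      rw [Finset.sum_eq_single_of_mem j hjF fun k hk hkj => by simp [hz k hk hkj],
        Finset.sum_eq_single_of_mem j hjF fun k hk hkj => by simp [hz k hk hkj, hp0],
        hterm, ENNReal.mul_rpow_of_nonneg _ _ hp0.le]
    · have hz : ∀ k ∈ F, φ k x = 0 := fun k hk => hφs k x fun h => hj ⟨k, hk, h⟩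
      rw [Finset.sum_eq_zero fun k hk => by simp [hz k hk],
        Finset.sum_eq_zero fun k hk => by simp [hz k hk, hp0]]
      simp [hp0]
  have hint : ∀ p : ℝ, 0 < p → ∀ (v : Rn n → ℝ≥0∞), AEMeasurable v → ∀ A : Set (Rn n),
      ∫⁻ x in A, ‖∑ k ∈ F, (b k).toReal * φ k x‖ₑ ^ p * v x =
        ∑ k ∈ F, b k ^ p * ∫⁻ x in A, ‖φ k x‖ₑ ^ p * v x := fun p hp0 v hv A => by
    have hm : ∀ k, AEMeasurable (fun x => ‖φ k x‖ₑ ^ p * v x) (volume.restrict A) := fun k =>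
      (((hφm k).enorm.pow_const _).mul hv).restrict
    simp_rw [hpow p hp0, Finset.sum_mul, mul_assoc]
    rw [lintegral_finsetSum' _ fun k _ => (hm k).const_mul _]
    exact Finset.sum_congr rfl fun k _ => lintegral_const_mul'' _ (hm k)
  refine ⟨fun x => ∑ k ∈ F, (b k).toReal * φ k x,
    Finset.aemeasurable_fun_sum _ fun k _ => (hφm k).const_mul _, ?_, fun k => ?_, ?_⟩
  · rw [← setLIntegral_univ, hint p₂ hp₂ v₂ hv₂.1]
    refine ENNReal.sum_ne_top.2 fun k _ => ENNReal.mul_ne_top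
      (ENNReal.rpow_ne_top_of_nonneg hp₂.le (hb k)) ?_
    rw [setLIntegral_univ]
    exact ((hφ2 k).trans_lt ENNReal.one_lt_top).ne
  · rw [hint p₂ hp₂ v₂ hv₂.1]
    have hinj : Function.Injective fun i : ℕ => k + (i : ℤ) := fun i j h => by simpa using h
    calc _ ≤ ∑ j ∈ F, {j : ℤ | k ≤ j}.indicator (fun j => b j ^ p₂) j := by
          refine Finset.sum_le_sum fun j _ => ?_
          by_cases hkj : k ≤ j
          · rw [indicator_of_mem (s := {j : ℤ | k ≤ j}) hkj]
            refine mul_le_of_le_one_right' ?_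
            exact (setLIntegral_le_lintegral _ _).trans (hφ2 j)
          · have hz : ∫⁻ x in (radialSub n θ ω (2 ^ k))ᶜ, ‖φ j x‖ₑ ^ p₂ * v₂ x = 0 := by
              rw [setLIntegral_congr_fun (g := fun _ => 0) (measurableSet_radialSub _).compl]
              · simp
              · intro x hx
                have : φ j x = 0 := hφs j x fun h =>
                  hx (annulus_subset_radialSub (not_le.1 hkj) h)
                simp [this, hp₂]
            rw [hz, mul_zero]
            exact zero_le
      _ = ∑' j : ℤ, (F : Set ℤ).indicator
            ({j : ℤ | k ≤ j}.indicator fun j => b j ^ p₂) j := sum_eq_tsum_indicator _ _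
      _ = _ := by
        rw [← hinj.tsum_eq]
        · refine tsum_congr fun i => ?_
          simp [indicator]
        · intro j hj
          have hkj : k ≤ j := by
            by_contra h
            exact hj (by simp [indicator, h])
          exact ⟨(j - k).toNat, by simp [Int.toNat_of_nonneg (sub_nonneg.2 hkj)]⟩
  · rw [← setLIntegral_univ fun x => ‖∑ k ∈ F, (b k).toReal * φ k x‖ₑ ^ p₁ * v₁ x,
      hint p₁ hp₁ v₁ hv₁.1]
    refine Finset.sum_le_sum fun k _ => mul_le_mul_right ?_ _
    rw [setLIntegral_univ]
    exact hφ1 k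

/-- With coefficients `2^{-k}` the tail of the test function outside `E_k` is a geometric series of
size `2^{-k}`, so its Morrey norm is bounded by a constant. -/
lemma sum_le_of_isEmbeddingConst_top (hp₁ : 0 < p₁) (hp : p₁ ≤ p₂)
    (hv₁ : IsWeight v₁) (hv₂ : IsWeight v₂) (hω : DualOmega ∞ ω) {c : ℝ≥0}
    (hc : IsEmbeddingConst p₁ p₂ ∞ ω v₁ v₂ c)
    (hfin : ∀ k, ratioNorm p₁ p₂ v₁ v₂ (annulus n ∞ ω k) ≠ ∞) (F : Finset ℤ) :
    ∑ k ∈ F, (2 : ℝ≥0∞) ^ (-((k : ℝ) * p₁)) *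
        (ratioNorm p₁ p₂ v₁ v₂ (annulus n ∞ ω k) / 2) ^ p₁ ≤
      (c * (2 * geom p₂ ^ (1 / p₂))) ^ p₁ := by
  have hp₂ := hp₁.trans_le hp
  obtain ⟨f, hf, hfin', hM, hL⟩ := exists_combination hp₁ hp hv₁ hv₂ hfin F
    (b := fun k => (2 : ℝ≥0∞) ^ (-(k : ℝ))) fun k => two_rpow_ne_top _
  refine le_trans (le_of_eq ?_) (hL.trans (lintegral_le_of_isEmbeddingConst hp₁ hp hc hf hfin'
    (X := 2 * geom p₂ ^ (1 / p₂)) ?_ ?_))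
  · simp_rw [← ENNReal.rpow_mul, neg_mul]
  · exact ENNReal.mul_ne_top ENNReal.ofNat_ne_top
      (ENNReal.rpow_ne_top_of_nonneg (by positivity) (geom_ne_top hp₂))
  rw [dualMorreyNorm_ofReal hp₂]
  refine (essSup_morrey_le hω (by positivity)).trans (iSup_le fun k => ?_)
  have hMk : ∫⁻ x in (radialSub n ∞ ω (2 ^ k))ᶜ, ‖f x‖ₑ ^ p₂ * v₂ x ≤
      2 ^ (-((k : ℝ) * p₂)) * geom p₂ := by
    refine (hM k).trans ?_
    rw [geom, ← ENNReal.tsum_mul_left]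
    refine ENNReal.tsum_le_tsum fun i => (indicator_le_self _ _ _).trans_eq ?_
    rw [← ENNReal.rpow_mul, ← two_rpow_add]
    push_cast
    ring_nf
  refine (mul_le_mul_right (ENNReal.rpow_le_rpow hMk (by positivity)) _).trans_eq ?_
  rw [ENNReal.mul_rpow_of_nonneg _ _ (by positivity), ← ENNReal.rpow_mul, ← mul_assoc]
  congr 1
  rw [two_zpow_eq, ← two_rpow_add]
  nth_rewrite 2 [← ENNReal.rpow_one 2]
  congr 1
  push_cast
  field_simp
  ring

lemma sum_le_of_isEmbeddingConst (hp₁ : 0 < p₁) (hp : p₁ ≤ p₂)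
    (hθ : ENNReal.ofReal p₁ < θ) (hθt : θ ≠ ∞)
    (hv₁ : IsWeight v₁) (hv₂ : IsWeight v₂) (hω : DualOmega θ ω) {c : ℝ≥0}
    (hc : IsEmbeddingConst p₁ p₂ θ ω v₁ v₂ c)
    (hfin : ∀ k, ratioNorm p₁ p₂ v₁ v₂ (annulus n θ ω k) ≠ ∞) (F : Finset ℤ) :
    ∑ k ∈ F, (2 : ℝ≥0∞) ^ (-((k : ℝ) * stieltjesExp p₁ θ)) *
        (ratioNorm p₁ p₂ v₁ v₂ (annulus n θ ω k) / 2) ^ stieltjesExp p₁ θ ≤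
      (2 ^ θ.toReal * (geom (θ.toReal / (2 * (θ.toReal / p₂))) ^ (θ.toReal / p₂) *
        geom (θ.toReal / 2))) ^ (stieltjesExp p₁ θ / θ.toReal) * c ^ stieltjesExp p₁ θ := by
  have hp₂ := hp₁.trans_le hp
  have hθ0 : θ ≠ 0 := (zero_le.trans_lt hθ).ne'
  have hτ := ENNReal.toReal_pos hθ0 hθt
  have hpτ : p₁ < θ.toReal := (ENNReal.ofReal_lt_iff_lt_toReal hp₁.le hθt).1 hθ
  set r := stieltjesExp p₁ θ with hr
  have hr0 : 0 < r := stieltjesExp_pos hp₁ hθ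
  have hre : r = p₁ * θ.toReal / (θ.toReal - p₁) := by rw [hr, stieltjesExp, if_neg hθt]
  set τ := θ.toReal with hτdef
  have hsub : 0 < τ - p₁ := sub_pos.2 hpτ
  set H := geom (τ / (2 * (τ / p₂))) ^ (τ / p₂) * geom (τ / 2) with hH
  have hHt : H ≠ ∞ := ENNReal.mul_ne_top
    (ENNReal.rpow_ne_top_of_nonneg (by positivity) (geom_ne_top (by positivity)))
    (geom_ne_top (by positivity))
  set l : ℤ → ℝ≥0∞ := fun k => ratioNorm p₁ p₂ v₁ v₂ (annulus n θ ω k) / 2 with hl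
  have hlt : ∀ k, l k ≠ ∞ := fun k => ENNReal.div_ne_top (hfin k) two_ne_zero
  set Y := ∑ k ∈ F, (2 : ℝ≥0∞) ^ (-((k : ℝ) * r)) * l k ^ r with hY
  have hYt : Y ≠ ∞ := ENNReal.sum_ne_top.2 fun k _ => ENNReal.mul_ne_top (two_rpow_ne_top _)
    (ENNReal.rpow_ne_top_of_nonneg hr0.le (hlt k))
  -- Equality case of Hölder for sequences: both `(b k * l k) ^ p₁` and `(2^k * b k) ^ τ` become
  -- `(2^{-k} l k) ^ r`, so both sides of the tested inequality are expressed through `Y`.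
  set b : ℤ → ℝ≥0∞ := fun k => 2 ^ (-((k : ℝ) * (τ / (τ - p₁)))) * l k ^ (p₁ / (τ - p₁)) with hb
  have hbt : ∀ k, b k ≠ ∞ := fun k => ENNReal.mul_ne_top (two_rpow_ne_top _)
    (ENNReal.rpow_ne_top_of_nonneg (by positivity) (hlt k))
  obtain ⟨f, hf, hfin', hM, hL⟩ := exists_combination hp₁ hp hv₁ hv₂ hfin F hbt
  have hYL : Y ≤ ∫⁻ x, ‖f x‖ₑ ^ p₁ * v₁ x := by
    refine le_trans (le_of_eq (Finset.sum_congr rfl fun k _ => ?_)) hL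
    rw [hb, ENNReal.mul_rpow_of_nonneg _ _ hp₁.le, mul_assoc, ← ENNReal.rpow_mul,
      ← ENNReal.rpow_mul, ← ENNReal.rpow_add_of_nonneg _ _ (by positivity) hp₁.le]
    congr 2
    · rw [hre]
      field_simp
    · rw [hre]
      field_simp
      ring
  have hX : dualMorreyNorm (ENNReal.ofReal p₂) θ ω v₂ f ≤ (2 ^ τ * H * Y) ^ (1 / τ) := by
    rw [dualMorreyNorm_ofReal hp₂, unorm_le_iff hθ0 hθt, ← hτdef, ← ENNReal.rpow_mul,
      one_div_mul_cancel hτ.ne', ENNReal.rpow_one]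
    refine (lintegral_morrey_le hθ0 hθt hω (by positivity)).trans ?_
    have hq : 0 < τ / p₂ := div_pos hτ hp₂
    calc _ ≤ ∑' k : ℤ, 2 ^ τ * (2 ^ ((k : ℝ) * τ) *
          (∑' i : ℕ, (F : Set ℤ).indicator (fun k => b k ^ p₂) (k + i)) ^ (τ / p₂)) := by
          refine ENNReal.tsum_le_tsum fun k => ?_
          rw [← hτdef, ENNReal.mul_rpow_of_nonneg _ _ hτ.le, ← ENNReal.rpow_mul, ← mul_assoc,
            two_zpow_rpow, ← two_rpow_add, one_div_mul_eq_div]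
          refine mul_le_mul' (le_of_eq ?_) (ENNReal.rpow_le_rpow (hM k) hq.le)
          push_cast
          ring_nf
      _ ≤ 2 ^ τ * (H * ∑' k : ℤ, 2 ^ ((k : ℝ) * τ) *
          (F : Set ℤ).indicator (fun k => b k ^ p₂) k ^ (τ / p₂)) := by
          rw [ENNReal.tsum_mul_left]
          exact mul_le_mul_right (discrete_hardy hτ hq _) _
      _ = _ := by
        rw [mul_assoc (2 ^ τ) H Y, hY, sum_eq_tsum_indicator]
        refine congrArg (fun z => 2 ^ τ * (H * z)) ?_
        refine tsum_congr fun k => ?_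
        by_cases hk : k ∈ (F : Set ℤ)
        · rw [indicator_of_mem hk, indicator_of_mem hk, ← ENNReal.rpow_mul,
            mul_div_cancel₀ _ hp₂.ne', hb, ENNReal.mul_rpow_of_nonneg _ _ hτ.le, ← mul_assoc,
            ← ENNReal.rpow_mul, ← two_rpow_add, ← ENNReal.rpow_mul]
          congr 2
          · rw [hre]
            field_simp
            ring
          · rw [hre]
            field_simp
        · rw [indicator_of_notMem hk, indicator_of_notMem hk, ENNReal.zero_rpow_of_pos hq, mul_zero]
  have hXt : (2 ^ τ * H * Y) ^ (1 / τ) ≠ ∞ := ENNReal.rpow_ne_top_of_nonneg (by positivity)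
    (ENNReal.mul_ne_top (ENNReal.mul_ne_top (two_rpow_ne_top _) hHt) hYt)
  have hmain := hYL.trans (lintegral_le_of_isEmbeddingConst hp₁ hp hc hf hfin' hXt hX)
  by_cases hY0 : Y = 0
  · rw [hY0]
    exact zero_le
  -- The power `Y ^ (p₁/τ)` can be cancelled because `Y`, a finite sum of finite terms, is finite
  -- and non-zero.
  have h1 : Y ^ (p₁ / τ) * Y ^ (p₁ / r) ≤
      Y ^ (p₁ / τ) * ((2 ^ τ * H) ^ (p₁ / τ) * (c : ℝ≥0∞) ^ p₁) := by
    rw [← ENNReal.rpow_add _ _ hY0 hYt]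
    have e : p₁ / τ + p₁ / r = 1 := by
      rw [hre]
      field_simp
      ring
    rw [e, ENNReal.rpow_one]
    refine hmain.trans_eq ?_
    rw [ENNReal.mul_rpow_of_nonneg _ _ hp₁.le, ← ENNReal.rpow_mul, one_div_mul_eq_div,
      ENNReal.mul_rpow_of_nonneg _ _ (by positivity)]
    ring
  have h2 := (ENNReal.mul_le_mul_iff_right (by simp [hY0, hYt, ENNReal.rpow_eq_zero_iff])
    (ENNReal.rpow_ne_top_of_nonneg (by positivity) hYt)).1 h1
  have h3 := ENNReal.rpow_le_rpow h2 (div_pos hr0 hp₁).le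
  rw [← ENNReal.rpow_mul, div_mul_div_cancel₀ hr0.ne', div_self hp₁.ne', ENNReal.rpow_one,
    ENNReal.mul_rpow_of_nonneg _ _ (by positivity), ← ENNReal.rpow_mul, ← ENNReal.rpow_mul,
    mul_div_cancel₀ _ hp₁.ne'] at h3
  refine h3.trans_eq ?_
  congr 2
  field_simp

/-- The lower bound for admissible constants in terms of the dyadic sum. -/
lemma exists_ratioSum_le (hp₁ : 0 < p₁) (hp : p₁ ≤ p₂) (hθ : ENNReal.ofReal p₁ < θ) :
    ∃ K : ℝ≥0∞, K ≠ ∞ ∧ ∀ (n : ℕ), 1 ≤ n → ∀ v₁ v₂ : Rn n → ℝ≥0∞, IsWeight v₁ → IsWeight v₂ →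
      ∀ ω : ℝ → ℝ≥0∞, DualOmega θ ω → ∀ c : ℝ≥0, IsEmbeddingConst p₁ p₂ θ ω v₁ v₂ c →
        ratioSum p₁ p₂ θ ω v₁ v₂ ≤ K * c ^ stieltjesExp p₁ θ := by
  have hp₂ := hp₁.trans_le hp
  have hθ0 : θ ≠ 0 := (zero_le.trans_lt hθ).ne'
  set r := stieltjesExp p₁ θ with hr
  have hr0 : 0 < r := stieltjesExp_pos hp₁ hθ
  have hsum : ∃ K : ℝ≥0∞, K ≠ ∞ ∧ ∀ (n : ℕ), 1 ≤ n → ∀ v₁ v₂ : Rn n → ℝ≥0∞, IsWeight v₁ →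
      IsWeight v₂ → ∀ ω : ℝ → ℝ≥0∞, DualOmega θ ω → ∀ c : ℝ≥0,
      IsEmbeddingConst p₁ p₂ θ ω v₁ v₂ c →
      (∀ k, ratioNorm p₁ p₂ v₁ v₂ (annulus n θ ω k) ≠ ∞) → ∀ F : Finset ℤ,
      ∑ k ∈ F, (2 : ℝ≥0∞) ^ (-((k : ℝ) * r)) *
        (ratioNorm p₁ p₂ v₁ v₂ (annulus n θ ω k) / 2) ^ r ≤ K * c ^ r := by
    by_cases hθt : θ = ∞
    · subst hθt
      have hrp : r = p₁ := if_pos rfl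
      refine ⟨(2 * geom p₂ ^ (1 / p₂)) ^ p₁, ?_, fun n hn v₁ v₂ hv₁ hv₂ ω hω c hc hfin F => ?_⟩
      · exact ENNReal.rpow_ne_top_of_nonneg hp₁.le (ENNReal.mul_ne_top ENNReal.ofNat_ne_top
          (ENNReal.rpow_ne_top_of_nonneg (by positivity) (geom_ne_top hp₂)))
      · rw [hrp, mul_comm, ← ENNReal.mul_rpow_of_nonneg _ _ hp₁.le]
        exact sum_le_of_isEmbeddingConst_top hp₁ hp hv₁ hv₂ hω hc hfin F
    · have hτ := ENNReal.toReal_pos hθ0 hθt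
      refine ⟨_, ?_, fun n hn v₁ v₂ hv₁ hv₂ ω hω c hc hfin F =>
        sum_le_of_isEmbeddingConst hp₁ hp hθ hθt hv₁ hv₂ hω hc hfin F⟩
      refine ENNReal.rpow_ne_top_of_nonneg (by positivity)
        (ENNReal.mul_ne_top (two_rpow_ne_top _) (ENNReal.mul_ne_top ?_ ?_))
      · exact ENNReal.rpow_ne_top_of_nonneg (by positivity) (geom_ne_top (by positivity))
      · exact geom_ne_top (by positivity)
  obtain ⟨K, hK, hsum⟩ := hsum
  obtain ⟨σ, hσ, hsub⟩ := exists_ratioNorm_iUnion_le hp₁ hp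
  set H := geom (r / (2 * (r / σ))) ^ (r / σ) * geom (r / 2) with hH
  refine ⟨H * (2 ^ r * K), ?_, fun n hn v₁ v₂ hv₁ hv₂ ω hω c hc => ?_⟩
  · refine ENNReal.mul_ne_top (ENNReal.mul_ne_top ?_ ?_) (ENNReal.mul_ne_top (two_rpow_ne_top _) hK)
    · exact ENNReal.rpow_ne_top_of_nonneg (by positivity) (geom_ne_top (by positivity))
    · exact geom_ne_top (by positivity)
  -- The one-ball test, valid for every `θ`, already gives finiteness on each `E_{k+1}`.
  have hfin : ∀ k, ratioNorm p₁ p₂ v₁ v₂ (annulus n θ ω k) ≠ ∞ := fun k => by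
    refine ne_top_of_le_ne_top ?_ ((ratioNorm_mono (annulus_subset_radialSub (lt_add_one k))).trans
      (ratioNorm_radialSub_le hn hθ0 hp₁ hp (fun t ht =>
        ratioNorm_ball_le_of_isEmbeddingConst hp₁ hp hθ0 hv₁ hv₂ hω hc ht) _))
    rw [two_zpow_eq]
    exact ENNReal.mul_ne_top ENNReal.coe_ne_top (two_rpow_ne_top _)
  set w : ℤ → ℝ≥0∞ := fun k => ratioNorm p₁ p₂ v₁ v₂ (annulus n θ ω k) with hw
  -- Up to the origin `E_{k+1}` is the union of the annuli of index at most `k`; the reflected Hardy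
  -- inequality then removes the inner sum.
  have hE : ∀ k : ℤ, ratioNorm p₁ p₂ v₁ v₂ (radialSub n θ ω (2 ^ (k + 1))) ^ r ≤
      (∑' i : ℕ, w (k - i) ^ σ) ^ (r / σ) := fun k => by
    have h1 : ratioNorm p₁ p₂ v₁ v₂ (radialSub n θ ω (2 ^ (k + 1))) ≤
        ratioNorm p₁ p₂ v₁ v₂ (⋃ i : ℕ, annulus n θ ω (k - i)) := by
      rw [ratioNorm_eq_unorm, unorm_congr_set _ (radialSub_ae_subset hn hω k)]
      exact unorm_mono _ inter_subset_right _
    calc _ = (ratioNorm p₁ p₂ v₁ v₂ (radialSub n θ ω (2 ^ (k + 1))) ^ σ) ^ (r / σ) := by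
          rw [← ENNReal.rpow_mul, mul_div_cancel₀ _ hσ.ne']
      _ ≤ _ := ENNReal.rpow_le_rpow ((ENNReal.rpow_le_rpow h1 hσ.le).trans (hsub n v₁ v₂ _))
        (div_pos hr0 hσ).le
  calc ratioSum p₁ p₂ θ ω v₁ v₂
    _ ≤ ∑' k : ℤ, (2 : ℝ≥0∞) ^ (-((k : ℝ) * r)) * (∑' i : ℕ, w (k - i) ^ σ) ^ (r / σ) :=
      ENNReal.tsum_le_tsum fun k => mul_le_mul_right (hE k) _
    _ ≤ H * ∑' k : ℤ, (2 : ℝ≥0∞) ^ (-((k : ℝ) * r)) * (w k ^ σ) ^ (r / σ) :=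
      discrete_hardy' hr0 (div_pos hr0 hσ) _
    _ = H * (2 ^ r * ∑' k : ℤ, (2 : ℝ≥0∞) ^ (-((k : ℝ) * r)) * (w k / 2) ^ r) := by
      rw [← ENNReal.tsum_mul_left (a := 2 ^ r)]
      congr 1
      refine tsum_congr fun k => ?_
      rw [mul_left_comm, ← ENNReal.mul_rpow_of_nonneg _ _ hr0.le,
        ENNReal.mul_div_cancel two_ne_zero ENNReal.ofNat_ne_top, ← ENNReal.rpow_mul,
        mul_div_cancel₀ _ hσ.ne']
    _ ≤ H * (2 ^ r * (K * c ^ r)) := by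
      gcongr
      rw [ENNReal.tsum_eq_iSup_sum]
      exact iSup_le fun F => hsum n hn v₁ v₂ hv₁ hv₂ ω hω c hc hfin F
    _ = _ := by ring

end Lower

/-! ### Assembly of the two-sided estimates -/

section Main

variable {n : ℕ} {p₁ p₂ : ℝ} {θ : ℝ≥0∞} {ω : ℝ → ℝ≥0∞} {v₁ v₂ : Rn n → ℝ≥0∞}

lemma supQuantity_le_of_isEmbeddingConst (hp₁ : 0 < p₁) (hp : p₁ ≤ p₂) (h0 : θ ≠ 0)
    (hv₁ : IsWeight v₁) (hv₂ : IsWeight v₂) (hω : DualOmega θ ω) {c : ℝ≥0}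
    (hc : IsEmbeddingConst p₁ p₂ θ ω v₁ v₂ c) : supQuantity p₁ p₂ θ ω v₁ v₂ ≤ c := by
  refine iSup₂_le fun t ht => ?_
  have h' : 0 < cumul θ ω t ∧ cumul θ ω t < ∞ := hω.2 t ht
  have h := ratioNorm_ball_le_of_isEmbeddingConst hp₁ hp h0 hv₁ hv₂ hω hc ht
  rwa [← ENNReal.div_le_iff h'.1.ne' h'.2.ne, div_eq_mul_inv, mul_comm] at h

lemma stieltjesQuantity_le_ratioSum (hp₁ : 0 < p₁) (hθ : ENNReal.ofReal p₁ < θ)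
    (hω : DualOmega θ ω) :
    stieltjesQuantity p₁ p₂ θ ω v₁ v₂ hp₁ hθ hω ≤
      2 * ratioSum p₁ p₂ θ ω v₁ v₂ ^ (1 / stieltjesExp p₁ θ) := by
  have hr := stieltjesExp_pos hp₁ hθ
  have h0 : θ ≠ 0 := (zero_le.trans_lt hθ).ne'
  rw [two_mul]
  refine add_le_add (ENNReal.rpow_le_rpow ?_ (by positivity)) ?_
  · exact lintegral_lebesgueStieltjes_le _ h0 hr hω
  · rw [one_div, ENNReal.le_rpow_inv_iff hr]
    exact inv_unorm_mul_le hr hω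

lemma ratioSum_le_stieltjesQuantity (hn : 1 ≤ n) (hp₁ : 0 < p₁) (hp : p₁ ≤ p₂)
    (hθ : ENNReal.ofReal p₁ < θ) (hω : DualOmega θ ω) :
    ratioSum p₁ p₂ θ ω v₁ v₂ ^ (1 / stieltjesExp p₁ θ) ≤
      (2 * (2 ^ stieltjesExp p₁ θ * (geom (stieltjesExp p₁ θ) * 2 ^ stieltjesExp p₁ θ))) ^
        (1 / stieltjesExp p₁ θ) * stieltjesQuantity p₁ p₂ θ ω v₁ v₂ hp₁ hθ hω := by
  have hr := stieltjesExp_pos hp₁ hθ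
  have h0 : θ ≠ 0 := (zero_le.trans_lt hθ).ne'
  rw [one_div, ENNReal.rpow_inv_le_iff hr, ENNReal.mul_rpow_of_nonneg _ _ hr.le,
    ENNReal.rpow_inv_rpow hr.ne', mul_comm 2, mul_assoc, two_mul]
  refine (dyadicSum_le_lebesgueStieltjes (monotone_negPow hp₁ hθ hω) hn h0
    (ratioExp_ne_zero hp₁ hp) hr hω).trans (mul_le_mul_right (add_le_add ?_ ?_) _)
  · rw [← ENNReal.rpow_inv_le_iff hr, ← one_div]
    exact le_self_add
  · exact ENNReal.rpow_le_rpow le_add_self hr.le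

end Main

end WeightedMorrey

end

theorem mainTheorem4 (n : ℕ) (hn : 1 ≤ n) (p₁ p₂ : ℝ) (hp₁ : 0 < p₁) (hp : p₁ ≤ p₂)
    (θ : ℝ≥0∞) (hθ : 0 < θ) :
    ∃ C : ℝ≥0, 0 < C ∧
      ∀ v₁ v₂ : WeightedMorrey.Rn n → ℝ≥0∞,
        WeightedMorrey.IsWeight v₁ → WeightedMorrey.IsWeight v₂ →
        ∀ (ω : ℝ → ℝ≥0∞) (hω : WeightedMorrey.DualOmega θ ω),
          (θ ≤ ENNReal.ofReal p₁ →
            WeightedMorrey.embeddingNorm p₁ p₂ θ ω v₁ v₂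
                ≤ C * WeightedMorrey.supQuantity p₁ p₂ θ ω v₁ v₂ ∧
            WeightedMorrey.supQuantity p₁ p₂ θ ω v₁ v₂
                ≤ C * WeightedMorrey.embeddingNorm p₁ p₂ θ ω v₁ v₂) ∧
          (∀ h : ENNReal.ofReal p₁ < θ,
            WeightedMorrey.embeddingNorm p₁ p₂ θ ω v₁ v₂
                ≤ C * WeightedMorrey.stieltjesQuantity p₁ p₂ θ ω v₁ v₂ hp₁ h hω ∧
            WeightedMorrey.stieltjesQuantity p₁ p₂ θ ω v₁ v₂ hp₁ h hω
                ≤ C * WeightedMorrey.embeddingNorm p₁ p₂ θ ω v₁ v₂) := by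
  open WeightedMorrey in
  have hp₂ := hp₁.trans_le hp
  rcases le_or_gt θ (ENNReal.ofReal p₁) with hle | hlt
  · have hθt : θ ≠ ∞ := (hle.trans_lt ENNReal.ofReal_lt_top).ne
    have hτ := ENNReal.toReal_pos hθ.ne' hθt
    have hK : 2 * geom θ.toReal ^ (1 / θ.toReal) ≠ ∞ := ENNReal.mul_ne_top ENNReal.ofNat_ne_top
      (ENNReal.rpow_ne_top_of_nonneg (by positivity) (geom_ne_top hτ))
    -- The added `1` makes the constant at least `1`, as the lower bound here holds with constant
    -- `1`.
    refine ⟨(2 * geom θ.toReal ^ (1 / θ.toReal)).toNNReal + 1, by positivity,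
      fun v₁ v₂ hv₁ hv₂ ω hω => ⟨fun _ => ⟨?_, ?_⟩, fun h => absurd hle h.not_ge⟩⟩
    · rw [ENNReal.coe_add, ENNReal.coe_toNNReal hK]
      refine (embeddingNorm_le fun f hf => lebesgueNorm_le_supQuantity hn hp₁ hp hθ.ne' hle hv₁ hv₂
        hω hf).trans (mul_le_mul_left le_self_add _)
    · refine le_mul_embeddingNorm (by positivity) ENNReal.coe_ne_top fun c hc => ?_
      refine (supQuantity_le_of_isEmbeddingConst hp₁ hp hθ.ne' hv₁ hv₂ hω hc).trans ?_
      refine le_mul_of_one_le_left' ?_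
      rw [ENNReal.coe_add]
      exact le_add_self
  · have hr := stieltjesExp_pos hp₁ hlt
    set r := stieltjesExp p₁ θ with hrdef
    obtain ⟨K, hK, hlow⟩ := exists_ratioSum_le hp₁ hp hlt
    set A := (2 * (2 ^ r * (geom r * 2 ^ r))) ^ (1 / r) with hA
    have hAt : A ≠ ∞ := ENNReal.rpow_ne_top_of_nonneg (by positivity)
      (ENNReal.mul_ne_top ENNReal.ofNat_ne_top (ENNReal.mul_ne_top (two_rpow_ne_top _)
        (ENNReal.mul_ne_top (geom_ne_top hr) (two_rpow_ne_top _))))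
    have hup : ∃ B : ℝ≥0∞, B ≠ ∞ ∧ ∀ v₁ v₂ : Rn n → ℝ≥0∞, IsWeight v₁ → IsWeight v₂ →
        ∀ ω : ℝ → ℝ≥0∞, DualOmega θ ω → ∀ f : Rn n → ℝ, AEMeasurable f →
          lebesgueNorm (ENNReal.ofReal p₁) v₁ f ≤ B * ratioSum p₁ p₂ θ ω v₁ v₂ ^ (1 / r) *
            dualMorreyNorm (ENNReal.ofReal p₂) θ ω v₂ f := by
      by_cases hθt : θ = ∞
      · subst hθt
        refine ⟨1, ENNReal.one_ne_top, fun v₁ v₂ hv₁ hv₂ ω hω f hf => ?_⟩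
        rw [one_mul]
        exact lebesgueNorm_le_ratioSum_top hn hp₁ hp hv₁ hv₂ hω hf
      · have hτ := ENNReal.toReal_pos hθ.ne' hθt
        exact ⟨_, ENNReal.rpow_ne_top_of_nonneg (by positivity) (geom_ne_top hτ),
          fun v₁ v₂ hv₁ hv₂ ω hω f hf =>
            lebesgueNorm_le_ratioSum hn hp₁ hp hlt hθt hv₁ hv₂ hω hf⟩
    obtain ⟨B, hB, hup⟩ := hup
    have hL : 2 * K ^ (1 / r) ≠ ∞ := ENNReal.mul_ne_top ENNReal.ofNat_ne_top
      (ENNReal.rpow_ne_top_of_nonneg (by positivity) hK)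
    refine ⟨(B * A).toNNReal + (2 * K ^ (1 / r)).toNNReal + 1, by positivity,
      fun v₁ v₂ hv₁ hv₂ ω hω => ⟨fun h => absurd hlt h.not_gt, fun h => ⟨?_, ?_⟩⟩⟩
    · refine (embeddingNorm_le (hup v₁ v₂ hv₁ hv₂ ω hω)).trans ?_
      refine (mul_le_mul_right (ratioSum_le_stieltjesQuantity hn hp₁ hp h hω) B).trans ?_
      rw [← mul_assoc, ENNReal.coe_add, ENNReal.coe_add,
        ENNReal.coe_toNNReal (ENNReal.mul_ne_top hB hAt), add_assoc]
      exact mul_le_mul_left le_self_add _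
    · refine le_mul_embeddingNorm (by positivity) ENNReal.coe_ne_top fun c hc => ?_
      refine (stieltjesQuantity_le_ratioSum hp₁ h hω).trans ?_
      calc _ ≤ 2 * (K * (c : ℝ≥0∞) ^ r) ^ (1 / r) :=
            mul_le_mul_right (ENNReal.rpow_le_rpow (hlow n hn v₁ v₂ hv₁ hv₂ ω hω c hc)
              (by positivity)) _
        _ = 2 * K ^ (1 / r) * c := by
            rw [ENNReal.mul_rpow_of_nonneg _ _ (by positivity), ← ENNReal.rpow_mul,
              mul_one_div_cancel hr.ne', ENNReal.rpow_one, mul_assoc]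
        _ ≤ _ := by
            refine mul_le_mul_left ?_ _
            rw [ENNReal.coe_add, ENNReal.coe_add, ENNReal.coe_toNNReal hL]
            exact le_add_self.trans le_self_add
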